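/- Let $G$ be a finite, simple, connected, $4$-regular graph with $n$ vertices, and let $G^\sigma$ be an orientation of $G$ (each edge receives exactly one direction). Let $S=[s_{xy}]$ be its skew-adjacency matrix: $s_{xy}=1$ and $s_{yx}=-1$ if $\langle x,y\rangle$ is an arc, and $s_{xy}=0$ if $x,y$ are not adjacent. Suppose that $G^\sigma$ has optimum skew energy, i.e. the sum of the absolute values of all eigenvalues of $S$ (with multiplicity) equals $n\sqrt{\Delta}$, where $\Delta$ (here $\Delta=4$) is the maximum degree. Then $G$ is isomorphic to one of the following graphs. 1. $G_1$: vertices $u_1,\dots,u_4,v_1,\dots,v_4$; edges $u_ku_l$ and $v_kv_l$ for $1\le k<l\le 4$, and $u_kv_k$ for $1\le k\le 4$. 2. $G_2$: vertices $u_1,\dots,u_6$; edges $u_1u_2,u_1u_3,u_1u_4,u_1u_5,u_2u_3,u_2u_5,u_2u_6,u_3u_4,u_3u_6,u_4u_5,u_4u_6,u_5u_6$. 3. $G_3$: vertices $u,v,w,u_1,\dots,u_6,v_1,\dots,v_5$; edges $uu_1,uu_2,uv_1,uv_2$, $u_1v,u_1u_3,u_1u_4$, $u_2v,u_2v_3,u_2v_4$,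 $v_1u_3,v_1v_3,v_1w$, $v_2u_4,v_2v_4,v_2w$, $vu_5,vu_6$, $u_3u_5,u_3v_5$, $u_4u_6,u_4v_5$, $v_3u_6,v_3v_5$, $v_4u_5,v_4v_5$, $wu_5,wu_6$. 4. $Q_4$, the $4$-dimensional hypercube. 5. $\mathcal G_i$ for some integer $i\ge 1$. Here $\mathcal G_1$ has vertices $u,v,u_1,\dots,u_4,v_1,\dots,v_4$; each of $u,v$ is joined to each of $u_1,u_2,v_1,v_2$; each of $u_1,u_2$ to each of $u_3,u_4$; each of $v_1,v_2$ to each of $v_3,v_4$; each of $u_3,u_4$ to each of $v_3,v_4$. For $i\ge 2$, $\mathcal G_i$ is obtained from $\mathcal G_{i-1}$ by deleting the four edges between $\{u_{2i-1},u_{2i}\}$ and $\{v_{2i-1},v_{2i}\}$, adding new vertices $u_{2i+1},u_{2i+2},v_{2i+1},v_{2i+2}$, and adding all edges between $\{u_{2i-1},u_{2i}\}$ and $\{u_{2i+1},u_{2i+2}\}$, between $\{v_{2i-1},v_{2i}\}$ and $\{v_{2i+1},v_{2i+2}\}$, and between $\{u_{2i+1},u_{2i+2}\}$ and $\{v_{2i+1},v_{2i+2}\}$.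 6. $\mathcal H_j$ for some integer $j\ge 1$. Here $\mathcal H_1$ has vertices $u,v,u_1,\dots,u_4,v_1,v_2$; each of $u,v$ is joined to each of $u_1,u_2,v_1,v_2$, and each of $u_1,u_2,v_1,v_2$ to each of $u_3,u_4$. For $j\ge 2$, $\mathcal H_j$ is obtained from $\mathcal H_{j-1}$ by deleting the four edges between $\{v_{2j-3},v_{2j-2}\}$ and $\{u_{2j-1},u_{2j}\}$, adding new vertices $v_{2j-1},v_{2j},u_{2j+1},u_{2j+2}$, and adding all edges between $\{v_{2j-3},v_{2j-2}\}$ and $\{v_{2j-1},v_{2j}\}$, between $\{u_{2j-1},u_{2j}\}$ and $\{u_{2j+1},u_{2j+2}\}$, and between $\{v_{2j-1},v_{2j}\}$ and $\{u_{2j+1},u_{2j+2}\}$. -/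

import Mathlib

namespace SkewEnergy

/-- An orientation of a simple graph `G`: `arc x y` says that `⟨x, y⟩` is an arc. Every arc lies
on an edge of `G`, and every edge of `G` receives exactly one of its two directions. -/
structure GraphOrientation {V : Type*} (G : SimpleGraph V) where
  arc : V → V → Prop
  adj_of_arc : ∀ x y, arc x y → G.Adj x y
  arc_or_arc : ∀ x y, G.Adj x y → arc x y ∨ arc y x
  asymm : ∀ x y, arc x y → ¬ arc y x

section Energy

variable {V : Type*} {G : SimpleGraph V}

open Classical in
/-- The skew-adjacency matrix `S(G^σ)`. -/
noncomputable def GraphOrientation.skewAdjMatrix (σ : GraphOrientation G) : Matrix V V ℝ :=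
  Matrix.of fun x y => if σ.arc x y then 1 else if σ.arc y x then -1 else 0

/-- The skew energy: the sum of the absolute values of all (complex) eigenvalues of the
skew-adjacency matrix, counted with algebraic multiplicity. -/
noncomputable def GraphOrientation.skewEnergy [Fintype V] [DecidableEq V]
    (σ : GraphOrientation G) : ℝ :=
  ((σ.skewAdjMatrix.map (algebraMap ℝ ℂ)).charpoly.roots.map fun z => ‖z‖).sum

/-- An orientation has optimum skew energy if its skew energy equals `n √Δ`, where `n` is the
number of vertices and `Δ` is the maximum degree. -/
def GraphOrientation.IsOptimum [Fintype V] [DecidableEq V] [DecidableRel G.Adj]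
    (σ : GraphOrientation G) : Prop :=
  σ.skewEnergy = (Fintype.card V : ℝ) * Real.sqrt (G.maxDegree : ℝ)

end Energy

/-! ### The four exceptional graphs -/

/-- The edges of `G₁`; the vertices `u₁, …, u₄, v₁, …, v₄` are numbered `0, …, 7`. -/
def edgesG₁ : Finset (Sym2 (Fin 8)) :=
  {s(0, 1), s(0, 2), s(0, 3), s(1, 2), s(1, 3), s(2, 3),
    s(4, 5), s(4, 6), s(4, 7), s(5, 6), s(5, 7), s(6, 7),
    s(0, 4), s(1, 5), s(2, 6), s(3, 7)}

/-- The graph `G₁`. -/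
def graphG₁ : SimpleGraph (Fin 8) := SimpleGraph.fromEdgeSet (edgesG₁ : Set (Sym2 (Fin 8)))

/-- The edges of `G₂`; the vertices `u₁, …, u₆` are numbered `0, …, 5`. -/
def edgesG₂ : Finset (Sym2 (Fin 6)) :=
  {s(0, 1), s(0, 2), s(0, 3), s(0, 4), s(1, 2), s(1, 4), s(1, 5), s(2, 3), s(2, 5), s(3, 4),
    s(3, 5), s(4, 5)}

/-- The graph `G₂`. -/
def graphG₂ : SimpleGraph (Fin 6) := SimpleGraph.fromEdgeSet (edgesG₂ : Set (Sym2 (Fin 6)))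

/-- The edges of `G₃`; the vertices `u, u₁, u₂, v₁, v₂, v, u₃, u₄, v₃, v₄, w, u₅, u₆, v₅` are
numbered `0, …, 13`, in this order. -/
def edgesG₃ : Finset (Sym2 (Fin 14)) :=
  {s(0, 1), s(0, 2), s(0, 3), s(0, 4), s(1, 5), s(1, 6), s(1, 7), s(2, 5), s(2, 8), s(2, 9),
    s(3, 6), s(3, 8), s(3, 10), s(4, 7), s(4, 9), s(4, 10), s(5, 11), s(5, 12), s(6, 11),
    s(6, 13), s(7, 12), s(7, 13), s(8, 12), s(8, 13), s(9, 11), s(9, 13), s(10, 11), s(10, 12)}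

/-- The graph `G₃`. -/
def graphG₃ : SimpleGraph (Fin 14) := SimpleGraph.fromEdgeSet (edgesG₃ : Set (Sym2 (Fin 14)))

/-- The hypercube `Q₄`: 0-1 strings of length four, adjacent when they differ in exactly one
position. -/
def graphQ₄ : SimpleGraph (Fin 4 → Bool) where
  Adj x y := hammingDist x y = 1
  symm := ⟨fun x y h => by rw [hammingDist_comm]; exact h⟩
  loopless := ⟨fun x h => by simp [hammingDist_self] at h⟩

/-! ### The two infinite classes -/

/-- The symbols `u`, `v`, `u_k`, `v_k` that name the vertices of the graphs of both classes. -/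
inductive Label : Type
  | u : Label
  | v : Label
  | us (k : ℕ) : Label
  | vs (k : ℕ) : Label

open Label

/-- The vertex set of `𝓖_i`, for `i ≥ 1` (the value at `0` is not used). The last line is the
step from `𝓖_{i-1}` to `𝓖_i` for `i = n + 2`. -/
def vertsG : ℕ → Set Label
  | 0 => ∅
  | 1 => {u, v} ∪ {us 1, us 2, vs 1, vs 2} ∪ {us 3, us 4, vs 3, vs 4}
  | n + 2 => vertsG (n + 1) ∪ {us (2 * n + 5), us (2 * n + 6), vs (2 * n + 5), vs (2 * n + 6)}

/-- The edge set of `𝓖_i`, for `i ≥ 1` (the value at `0` is not used). The last clause is the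
step from `𝓖_{i-1}` to `𝓖_i` for `i = n + 2`, so that `2i-1, 2i, 2i+1, 2i+2` are
`2n+3, 2n+4, 2n+5, 2n+6`. -/
def edgesG : ℕ → Set (Sym2 Label)
  | 0 => ∅
  | 1 =>
    {s(u, us 1), s(u, us 2), s(u, vs 1), s(u, vs 2),
      s(v, us 1), s(v, us 2), s(v, vs 1), s(v, vs 2)} ∪
    {s(us 1, us 3), s(us 1, us 4), s(us 2, us 3), s(us 2, us 4),
      s(vs 1, vs 3), s(vs 1, vs 4), s(vs 2, vs 3), s(vs 2, vs 4)} ∪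
    {s(us 3, vs 4), s(vs 4, us 4), s(us 4, vs 3), s(vs 3, us 3)}
  | n + 2 =>
    (edgesG (n + 1) \
      {s(us (2 * n + 3), vs (2 * n + 4)), s(vs (2 * n + 4), us (2 * n + 4)),
        s(us (2 * n + 4), vs (2 * n + 3)), s(vs (2 * n + 3), us (2 * n + 3))}) ∪
    {s(us (2 * n + 3), us (2 * n + 5)), s(us (2 * n + 3), us (2 * n + 6)),
      s(us (2 * n + 4), us (2 * n + 5)), s(us (2 * n + 4), us (2 * n + 6))} ∪
    {s(vs (2 * n + 3), vs (2 * n + 5)), s(vs (2 * n + 3), vs (2 * n + 6)),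
      s(vs (2 * n + 4), vs (2 * n + 5)), s(vs (2 * n + 4), vs (2 * n + 6))} ∪
    {s(us (2 * n + 5), vs (2 * n + 6)), s(vs (2 * n + 6), us (2 * n + 6)),
      s(us (2 * n + 6), vs (2 * n + 5)), s(vs (2 * n + 5), us (2 * n + 5))}

/-- The graph `𝓖_i`. -/
def graphG (i : ℕ) : SimpleGraph (vertsG i) :=
  (SimpleGraph.fromEdgeSet (edgesG i)).induce (vertsG i)

/-- The vertex set of `𝓗_j`, for `j ≥ 1` (the value at `0` is not used). The last line is the
step from `𝓗_{j-1}` to `𝓗_j` for `j = n + 2`. -/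
def vertsH : ℕ → Set Label
  | 0 => ∅
  | 1 => {u, v} ∪ {us 1, us 2, vs 1, vs 2} ∪ {us 3, us 4}
  | n + 2 => vertsH (n + 1) ∪ {vs (2 * n + 3), vs (2 * n + 4), us (2 * n + 5), us (2 * n + 6)}

/-- The edge set of `𝓗_j`, for `j ≥ 1` (the value at `0` is not used). The last clause is the
step from `𝓗_{j-1}` to `𝓗_j` for `j = n + 2`, so that `2j-3, 2j-2, 2j-1, 2j, 2j+1, 2j+2` are
`2n+1, 2n+2, 2n+3, 2n+4, 2n+5, 2n+6`. -/
def edgesH : ℕ → Set (Sym2 Label)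
  | 0 => ∅
  | 1 =>
    {s(u, us 1), s(u, us 2), s(u, vs 1), s(u, vs 2),
      s(v, us 1), s(v, us 2), s(v, vs 1), s(v, vs 2)} ∪
    {s(us 1, us 3), s(us 1, us 4), s(us 2, us 3), s(us 2, us 4),
      s(vs 1, us 3), s(vs 1, us 4), s(vs 2, us 3), s(vs 2, us 4)}
  | n + 2 =>
    (edgesH (n + 1) \
      {s(vs (2 * n + 1), us (2 * n + 3)), s(vs (2 * n + 1), us (2 * n + 4)),
        s(vs (2 * n + 2), us (2 * n + 3)), s(vs (2 * n + 2), us (2 * n + 4))}) ∪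
    {s(vs (2 * n + 1), vs (2 * n + 3)), s(vs (2 * n + 1), vs (2 * n + 4)),
      s(vs (2 * n + 2), vs (2 * n + 3)), s(vs (2 * n + 2), vs (2 * n + 4))} ∪
    {s(us (2 * n + 3), us (2 * n + 5)), s(us (2 * n + 3), us (2 * n + 6)),
      s(us (2 * n + 4), us (2 * n + 5)), s(us (2 * n + 4), us (2 * n + 6))} ∪
    {s(vs (2 * n + 3), us (2 * n + 5)), s(vs (2 * n + 3), us (2 * n + 6)),
      s(vs (2 * n + 4), us (2 * n + 5)), s(vs (2 * n + 4), us (2 * n + 6))}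

/-- The graph `𝓗_j`. -/
def graphH (j : ℕ) : SimpleGraph (vertsH j) :=
  (SimpleGraph.fromEdgeSet (edgesH j)).induce (vertsH j)

/-- Membership in the set `𝓕` (graphs are taken up to isomorphism): `G` is one of `G₁`, `G₂`,
`G₃`, `Q₄`, `𝓖_i` with `i ≥ 1`, `𝓗_j` with `j ≥ 1`. -/
def MemF {V : Type*} (G : SimpleGraph V) : Prop :=
  Nonempty (G ≃g graphG₁) ∨ Nonempty (G ≃g graphG₂) ∨ Nonempty (G ≃g graphG₃) ∨
    Nonempty (G ≃g graphQ₄) ∨ (∃ i : ℕ, 1 ≤ i ∧ Nonempty (G ≃g graphG i)) ∨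
    (∃ j : ℕ, 1 ≤ j ∧ Nonempty (G ≃g graphH j))

end SkewEnergy

/-!
# Optimum skew energy of `4`-regular graphs

Let `S` be the skew-adjacency matrix of an optimum orientation of a connected `4`-regular graph `G`
on `n` vertices. The absolute values of its eigenvalues have sum `2 n` and their squares have sum
`tr (S Sᵀ) = 4 n`, so all of them are equal to `2`, and since `S` is normal, `S Sᵀ = 4 I`
(`mul_transpose_eq_of_extremal`). From here on only the orthogonality of the rows matters: two
vertices have an even number of common neighbors, and if they have two common neighbors at which
their rows have the same product, then orthogonality needs two more, so they are twins, that is,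
have the same neighborhood.

If there are twins `x`, `y`, then this sign rule splits their neighborhood into two pairs of twins,
and each pair of twins reached in this way has two adjacent pairs as its neighborhood. The sequence
of pairs closes up, so `G` is a cycle of length at least `3` with every vertex doubled
(`exists_iso_doubleCycle_of_pair_sequence`). These doubled cycles are `G₂` and the graphs of the two
infinite classes (`memF_of_iso_doubleCycle`).

Without twins, two vertices have none or exactly two common neighbors. A triangle then extends to a
`K₄`, whose four outer neighbors form another `K₄`, and `G` is `G₁`
(`HasNoneOrTwoCommon.nonempty_iso_graphG₁`). In the triangle-free case let `a, b, c, d` be the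
neighbors of a vertex `x`. Each of the six pairs of them has one further common neighbor, its
opposite. Every further vertex adjacent to two opposites sharing a point is adjacent to those of a
triangle or of a four-cycle on `a, b, c, d` (`IsOpposite.triangle_or_square`). Triangles lead to
`Q₄`, four-cycles to `G₃`.

The isomorphisms come from the remark that an injective homomorphism from a nonempty `d`-regular
graph to a connected `d`-regular graph is an isomorphism (`nonempty_iso_of_regular`).
-/

namespace SkewEnergy

/-! ### Skew-symmetric matrices of extremal energy -/

section Spectral

open Matrix Complex

variable {V : Type*} [Fintype V] [DecidableEq V]

/-- A real skew-symmetric matrix is unitarily diagonalizable, with purely imaginary eigenvalues: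
the spectral theorem applied to the Hermitian matrix `i A`. -/
theorem exists_unitary_diagonalization_of_skew {A : Matrix V V ℝ} (hA : Aᵀ = -A) :
    ∃ (U W : Matrix V V ℂ) (d : V → ℝ), U * W = 1 ∧ W * U = 1 ∧
      A.map (algebraMap ℝ ℂ) = U * diagonal (fun i => -I * (d i : ℂ)) * W := by
  have hH : (I • A.map (algebraMap ℝ ℂ)).IsHermitian := by
    ext i j
    have h := congrFun (congrFun hA i) j
    simp only [transpose_apply, Matrix.neg_apply] at h
    simp [conjTranspose_apply, h]
  refine ⟨hH.eigenvectorUnitary, star (hH.eigenvectorUnitary : Matrix V V ℂ), hH.eigenvalues,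
    Unitary.coe_mul_star_self _, Unitary.coe_star_mul_self _, ?_⟩
  have h := hH.spectral_theorem
  rw [Unitary.conjStarAlgAut_apply] at h
  have h2 : A.map (algebraMap ℝ ℂ) = (-I) • (I • A.map (algebraMap ℝ ℂ)) := by
    rw [smul_smul]; simp
  have h3 : diagonal (fun i => -I * (hH.eigenvalues i : ℂ)) =
      (-I) • diagonal (RCLike.ofReal ∘ hH.eigenvalues) := by
    ext i j
    by_cases hij : i = j <;> simp [diagonal, hij]
  rw [h3, mul_smul_comm, smul_mul_assoc, ← h, ← h2]

/-- If a real skew-symmetric matrix `A` of order `n` satisfies `tr (A Aᵀ) = 4 n` and its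
eigenvalues have absolute values summing to `2 n`, then all of them have absolute value `2`
(as `∑ (|z| - 2)² = 4 n - 4 ⬝ 2 n + 4 n = 0`), so that `A Aᵀ = 4 I`. -/
theorem mul_transpose_eq_of_extremal {A : Matrix V V ℝ} (hA : Aᵀ = -A)
    (htr : (A * Aᵀ).trace = 4 * Fintype.card V)
    (hE : (((A.map (algebraMap ℝ ℂ)).charpoly.roots.map fun z => ‖z‖).sum : ℝ) =
      2 * Fintype.card V) :
    A * Aᵀ = (4 : ℝ) • (1 : Matrix V V ℝ) := by
  obtain ⟨U, W, d, hUW, hWU, hd⟩ := exists_unitary_diagonalization_of_skew hA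
  have hsq : (A * Aᵀ).map (algebraMap ℝ ℂ) = U * diagonal (fun i => ((d i : ℂ)) ^ 2) * W := by
    have h1 : (A * Aᵀ).map (algebraMap ℝ ℂ) =
        -(A.map (algebraMap ℝ ℂ) * A.map (algebraMap ℝ ℂ)) := by
      rw [hA, mul_neg, ← Matrix.map_mul]
      ext i j
      simp
    rw [h1, hd]
    have h2 : U * diagonal (fun i => -I * (d i : ℂ)) * W *
        (U * diagonal (fun i => -I * (d i : ℂ)) * W) =
        U * (diagonal (fun i => -I * (d i : ℂ)) * (W * U) *
          diagonal (fun i => -I * (d i : ℂ))) * W := by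
      simp only [mul_assoc]
    rw [h2, hWU, mul_one, diagonal_mul_diagonal, ← neg_mul, ← mul_neg]
    congr 2
    ext i j
    by_cases hij : i = j
    · subst hij
      simp only [Matrix.neg_apply, diagonal_apply_eq]
      linear_combination (-(d i : ℂ) ^ 2) * I_sq
    · simp [hij]
  have hsum1 : ∑ i, |d i| = 2 * Fintype.card V := by
    have hroots : ∀ z : V → ℂ, (diagonal z).charpoly.roots = Finset.univ.val.map z := fun z => by
      rw [charpoly_diagonal, Polynomial.roots_prod _ _
        (Finset.prod_ne_zero_iff.2 fun i _ => Polynomial.X_sub_C_ne_zero _)]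
      simp
    rw [← hE, hd, charpoly_mul_comm, ← mul_assoc, hWU, one_mul, hroots, Multiset.map_map]
    simp
  have hsum2 : ∑ i, d i ^ 2 = 4 * Fintype.card V := by
    have h1 : ((A * Aᵀ).map (algebraMap ℝ ℂ)).trace = ∑ i, (d i : ℂ) ^ 2 := by
      rw [hsq, trace_mul_comm, ← mul_assoc, hWU, one_mul, trace_diagonal]
    have h2 : ((A * Aᵀ).map (algebraMap ℝ ℂ)).trace = (((A * Aᵀ).trace : ℝ) : ℂ) := by
      simp [trace]
    rw [h2, htr] at h1
    exact_mod_cast h1.symm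
  have hzero : ∑ i, (|d i| - 2) ^ 2 = 0 := by
    have h : ∀ i, (|d i| - 2) ^ 2 = d i ^ 2 - 4 * |d i| + 4 := fun i => by
      rw [← sq_abs (d i)]; ring
    simp only [h, Finset.sum_add_distrib, Finset.sum_sub_distrib, ← Finset.mul_sum, hsum1, hsum2]
    simp
    ring
  have hd2 : ∀ i, d i ^ 2 = 4 := fun i => by
    have h := (Finset.sum_eq_zero_iff_of_nonneg fun i _ => sq_nonneg _).1 hzero i
      (Finset.mem_univ i)
    have h2 : |d i| = 2 := by
      have := pow_eq_zero_iff (two_ne_zero) |>.1 h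
      linarith
    rw [← sq_abs, h2]; norm_num
  have h4 : diagonal (fun i => ((d i : ℂ)) ^ 2) = (4 : ℂ) • (1 : Matrix V V ℂ) := by
    rw [smul_one_eq_diagonal]
    congr 1
    ext i
    exact_mod_cast hd2 i
  rw [h4, mul_smul_comm, mul_one, smul_mul_assoc, hUW] at hsq
  ext i j
  have h := congrFun (congrFun hsq i) j
  simp only [map_apply, Matrix.smul_apply, Matrix.one_apply, coe_algebraMap, smul_eq_mul,
    mul_ite, mul_one, mul_zero] at h ⊢
  split_ifs at h ⊢ <;> exact_mod_cast h

end Spectral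

section Orientation

variable {V : Type*} {G : SimpleGraph V} (σ : GraphOrientation G)

theorem GraphOrientation.skewAdjMatrix_swap (x y : V) :
    σ.skewAdjMatrix y x = -σ.skewAdjMatrix x y := by
  simp only [GraphOrientation.skewAdjMatrix, Matrix.of_apply]
  have := σ.asymm x y
  split_ifs <;> simp_all

theorem GraphOrientation.skewAdjMatrix_eq_one_or {x y : V} (h : G.Adj x y) :
    σ.skewAdjMatrix x y = 1 ∨ σ.skewAdjMatrix x y = -1 := by
  simp only [GraphOrientation.skewAdjMatrix, Matrix.of_apply]
  have := σ.arc_or_arc x y h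
  split_ifs <;> simp_all

theorem GraphOrientation.skewAdjMatrix_eq_zero {x y : V} (h : ¬ G.Adj x y) :
    σ.skewAdjMatrix x y = 0 := by
  simp only [GraphOrientation.skewAdjMatrix, Matrix.of_apply]
  have h1 := σ.adj_of_arc x y
  have h2 := fun a => (σ.adj_of_arc y x a).symm
  split_ifs <;> simp_all

/-- In an optimum orientation of a connected `4`-regular graph, distinct rows of the
skew-adjacency matrix are orthogonal. -/
theorem GraphOrientation.IsOptimum.sum_mul_eq_zero [Fintype V] [DecidableEq V]
    [DecidableRel G.Adj] {σ : GraphOrientation G} [Nonempty V] (hreg : G.IsRegularOfDegree 4)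
    (hopt : σ.IsOptimum) {x y : V} (hxy : x ≠ y) :
    ∑ z, σ.skewAdjMatrix x z * σ.skewAdjMatrix y z = 0 := by
  have hE : σ.skewEnergy = 2 * Fintype.card V := by
    have h : G.maxDegree = 4 := hreg.maxDegree_eq
    have h2 : Real.sqrt ((4 : ℕ) : ℝ) = 2 := by
      rw [show ((4 : ℕ) : ℝ) = 2 ^ 2 by norm_num]
      exact Real.sqrt_sq (by norm_num)
    have h3 : σ.skewEnergy = (Fintype.card V : ℝ) * Real.sqrt (G.maxDegree : ℝ) := hopt
    rw [h3, h, h2, mul_comm]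
  have hskew : σ.skewAdjMatrix.transpose = -σ.skewAdjMatrix := by
    ext i j
    exact σ.skewAdjMatrix_swap i j
  have htr : (σ.skewAdjMatrix * σ.skewAdjMatrix.transpose).trace = 4 * Fintype.card V := by
    have h : ∀ i, (σ.skewAdjMatrix * σ.skewAdjMatrix.transpose).diag i = 4 := fun i => by
      rw [Matrix.diag_apply, Matrix.mul_apply]
      have h1 : ∀ j, σ.skewAdjMatrix i j * σ.skewAdjMatrix.transpose j i =
          if G.Adj i j then (1 : ℝ) else 0 := fun j => by
        rw [Matrix.transpose_apply]
        split_ifs with hij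
        · rcases σ.skewAdjMatrix_eq_one_or hij with h | h <;> rw [h] <;> norm_num
        · rw [σ.skewAdjMatrix_eq_zero hij, zero_mul]
      simp only [h1, Finset.sum_boole]
      have h2 := hreg i
      rw [← SimpleGraph.card_neighborFinset_eq_degree, SimpleGraph.neighborFinset_eq_filter] at h2
      rw [h2]
      norm_num
    simp only [Matrix.trace, h]
    simp [mul_comm]
  have hmain := mul_transpose_eq_of_extremal hskew htr hE
  have h := congrFun (congrFun hmain x) y
  simpa [Matrix.mul_apply, Matrix.one_apply_ne hxy] using h

end Orientation

/-! ### Recognizing connected graphs -/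

section Recognition

variable {V W : Type*} {G : SimpleGraph V} {K : SimpleGraph W}

/-- A nonempty set of vertices of a connected graph that is closed under taking neighbors
contains all vertices. -/
theorem mem_of_closed (hconn : G.Connected) {s : Set V} {x : V} (hx : x ∈ s)
    (hs : ∀ y ∈ s, ∀ z, G.Adj y z → z ∈ s) (y : V) : y ∈ s := by
  obtain ⟨p⟩ := hconn.preconnected x y
  induction p with
  | nil => exact hx
  | cons h _ ih => exact ih (hs _ hx _ h)

/-- An injective graph homomorphism into a connected graph is an isomorphism as soon as all
neighbors of image points are images of neighbors. -/
theorem nonempty_iso_of_lift [Nonempty W] (hconn : G.Connected) {f : W → V}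
    (hf : Function.Injective f) (hom : ∀ i j, K.Adj i j → G.Adj (f i) (f j))
    (lift : ∀ i v, G.Adj (f i) v → ∃ j, K.Adj i j ∧ f j = v) : Nonempty (G ≃g K) := by
  have hsurj : Function.Surjective f := by
    obtain ⟨i⟩ := ‹Nonempty W›
    refine fun y => mem_of_closed hconn (s := Set.range f) ⟨i, rfl⟩ ?_ y
    rintro _ ⟨j, rfl⟩ z hz
    obtain ⟨k, _, hk⟩ := lift j z hz
    exact ⟨k, hk⟩
  have e : K ≃g G :=
    { toEquiv := Equiv.ofBijective f ⟨hf, hsurj⟩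
      map_rel_iff' := by
        intro a b
        refine ⟨fun h : G.Adj (f a) (f b) => ?_, hom a b⟩
        obtain ⟨j, hj, hjb⟩ := lift a _ h
        rwa [← hf hjb] }
  exact ⟨e.symm⟩

/-- An injective graph homomorphism from a nonempty `d`-regular graph to a connected `d`-regular
graph is an isomorphism. -/
theorem nonempty_iso_of_regular [Nonempty W] [Fintype V] [Fintype W] [DecidableEq V]
    [DecidableRel G.Adj] [DecidableRel K.Adj]
    {d : ℕ} (hconn : G.Connected) (hG : G.IsRegularOfDegree d) (hK : K.IsRegularOfDegree d)
    {f : W → V} (hf : Function.Injective f) (hom : ∀ i j, K.Adj i j → G.Adj (f i) (f j)) :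
    Nonempty (G ≃g K) := by
  refine nonempty_iso_of_lift hconn hf hom fun i v hv => ?_
  have hsub : (K.neighborFinset i).image f ⊆ G.neighborFinset (f i) := by
    intro w hw
    obtain ⟨j, hj, rfl⟩ := Finset.mem_image.1 hw
    simpa using hom i j (by simpa using hj)
  have heq := Finset.eq_of_subset_of_card_le hsub (by
    rw [Finset.card_image_of_injective _ hf, SimpleGraph.card_neighborFinset_eq_degree,
      SimpleGraph.card_neighborFinset_eq_degree, hG, hK])
  have hv' : v ∈ (K.neighborFinset i).image f := by rw [heq]; simpa using hv
  obtain ⟨j, hj, hjv⟩ := Finset.mem_image.1 hv'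
  exact ⟨j, by simpa using hj, hjv⟩

end Recognition

/-! ### The two infinite classes as doubled cycles -/

/-- The lexicographic product of the cycle of length `m ≥ 3` with two isolated vertices: the
vertices lie in cells `0, …, m - 1` of size two, and two vertices are adjacent exactly when
their cells are cyclically consecutive, that is, differ by `1` or by `m - 1`. -/
def doubleCycle (m : ℕ) : SimpleGraph (Fin m × Bool) where
  Adj x y := x.1.1 + 1 = y.1.1 ∨ y.1.1 + 1 = x.1.1 ∨
    (x.1 ≠ y.1 ∧ (x.1.1 + (m - 1) = y.1.1 ∨ y.1.1 + (m - 1) = x.1.1))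
  symm := ⟨fun x y h => by
    rcases h with h | h | ⟨h, h' | h'⟩
    · exact Or.inr (Or.inl h)
    · exact Or.inl h
    · exact Or.inr (Or.inr ⟨h.symm, Or.inr h'⟩)
    · exact Or.inr (Or.inr ⟨h.symm, Or.inl h'⟩)⟩
  loopless := ⟨fun x h => by
    rcases h with h | h | ⟨h, _⟩
    · omega
    · omega
    · exact h rfl⟩

section Families

open Label

/-- The position of a label on the cycle of cells `…, {v₁, v₂}, {u, v}, {u₁, u₂}, …`. -/
def Label.cell : Label → ℤ
  | u => 0
  | v => 0
  | us k => (k + 1) / 2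
  | vs k => -((k + 1) / 2)

/-- Which of the two members of its cell a label is. -/
def Label.side : Label → Bool
  | u => false
  | v => true
  | us k => k % 2 = 0
  | vs k => k % 2 = 0

/-- The labels that occur in the graphs `𝓖_i` and `𝓗_j`; their indices start at `1`. -/
def Label.Valid (x : Label) : Prop := x ≠ us 0 ∧ x ≠ vs 0

theorem eq_u_or_v_iff (x : Label) : x = u ∨ x = v ↔ x.Valid ∧ x.cell = 0 := by
  cases x <;> simp [Label.cell, Label.Valid] <;> omega

theorem eq_us_or_us_iff (k : ℕ) (x : Label) :
    x = us (2 * k + 1) ∨ x = us (2 * k + 2) ↔ x.Valid ∧ x.cell = k + 1 := by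
  cases x <;> simp [Label.cell, Label.Valid] <;> omega

theorem eq_vs_or_vs_iff (k : ℕ) (x : Label) :
    x = vs (2 * k + 1) ∨ x = vs (2 * k + 2) ↔ x.Valid ∧ x.cell = -(k + 1) := by
  cases x <;> simp [Label.cell, Label.Valid] <;> omega

/-- The complete bipartite graph between `{a, b}` and `{c, d}`. -/
theorem mem_block {α : Type*} (a b c d x y : α) :
    s(x, y) ∈ ({s(a, c), s(a, d), s(b, c), s(b, d)} : Set (Sym2 α)) ↔
      (x = a ∨ x = b) ∧ (y = c ∨ y = d) ∨ (y = a ∨ y = b) ∧ (x = c ∨ x = d) := by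
  simp only [Set.mem_insert_iff, Set.mem_singleton_iff, Sym2.eq_iff]
  tauto

/-- The same four edges, listed in the order of a closed walk `a, d, b, c`. -/
theorem mem_cyclic_block {α : Type*} (a b c d x y : α) :
    s(x, y) ∈ ({s(a, d), s(d, b), s(b, c), s(c, a)} : Set (Sym2 α)) ↔
      (x = a ∨ x = b) ∧ (y = c ∨ y = d) ∨ (y = a ∨ y = b) ∧ (x = c ∨ x = d) := by
  simp only [Set.mem_insert_iff, Set.mem_singleton_iff, Sym2.eq_iff]
  tauto

theorem insert_four {α : Type*} (a b c d : α) (s : Set α) :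
    insert a (insert b (insert c (insert d s))) = {a, b, c, d} ∪ s := by
  simp [Set.insert_union, Set.singleton_union]

theorem mem_star_block {α : Type*} (a b c d e f x y : α) :
    s(x, y) ∈ ({s(a, c), s(a, d), s(a, e), s(a, f), s(b, c), s(b, d), s(b, e), s(b, f)} :
        Set (Sym2 α)) ↔
      ((x = a ∨ x = b) ∧ (y = c ∨ y = d) ∨ (y = a ∨ y = b) ∧ (x = c ∨ x = d)) ∨
      ((x = a ∨ x = b) ∧ (y = e ∨ y = f) ∨ (y = a ∨ y = b) ∧ (x = e ∨ x = f)) := by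
  rw [← mem_block, ← mem_block, ← Set.mem_union]
  simp only [Set.mem_insert_iff, Set.mem_singleton_iff, Set.mem_union]
  tauto

theorem mem_two_blocks {α : Type*} (a b c d a' b' c' d' x y : α) :
    s(x, y) ∈ ({s(a, c), s(a, d), s(b, c), s(b, d), s(a', c'), s(a', d'), s(b', c'), s(b', d')} :
        Set (Sym2 α)) ↔
      ((x = a ∨ x = b) ∧ (y = c ∨ y = d) ∨ (y = a ∨ y = b) ∧ (x = c ∨ x = d)) ∨
      ((x = a' ∨ x = b') ∧ (y = c' ∨ y = d') ∨ (y = a' ∨ y = b') ∧ (x = c' ∨ x = d')) := by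
  rw [← mem_block, ← mem_block, ← Set.mem_union, ← insert_four]

theorem mem_vertsG (n : ℕ) (x : Label) :
    x ∈ vertsG (n + 1) ↔ x.Valid ∧ -(n + 2 : ℤ) ≤ x.cell ∧ x.cell ≤ n + 2 := by
  induction n with
  | zero =>
    cases x <;> simp [vertsG, Label.cell, Label.Valid] <;> omega
  | succ n ih =>
    rw [vertsG, Set.mem_union, ih]
    cases x <;> simp [Label.cell, Label.Valid] <;> omega

/-- The edges of `𝓖_{n+1}` join cells that are consecutive on a cycle of `2 n + 5` cells, with the
positions `n + 2` and `-(n + 2)` at the two ends; the edges deleted in the recursive step are those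
that close the shorter cycle. -/
theorem mem_edgesG (n : ℕ) (x y : Label) :
    s(x, y) ∈ edgesG (n + 1) ↔ x ∈ vertsG (n + 1) ∧ y ∈ vertsG (n + 1) ∧
      (x.cell - y.cell = 1 ∨ y.cell - x.cell = 1 ∨
        x.cell - y.cell = 2 * n + 4 ∨ y.cell - x.cell = 2 * n + 4) := by
  induction n with
  | zero =>
    have hu1 := eq_us_or_us_iff 0
    have hu3 := eq_us_or_us_iff 1
    have hv1 := eq_vs_or_vs_iff 0
    have hv3 := eq_vs_or_vs_iff 1
    norm_num at hu1 hu3 hv1 hv3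
    rw [edgesG, Set.mem_union, Set.mem_union, mem_star_block, mem_two_blocks, mem_cyclic_block,
      mem_vertsG, mem_vertsG]
    simp only [eq_u_or_v_iff, hu1, hu3, hv1, hv3]
    push_cast
    by_cases hx : x.Valid <;> by_cases hy : y.Valid <;>
      simp only [hx, hy, true_and, false_and, and_false, or_self] <;> omega
  | succ n ih =>
    have hu3 := eq_us_or_us_iff (n + 1)
    have hu5 := eq_us_or_us_iff (n + 2)
    have hv3 := eq_vs_or_vs_iff (n + 1)
    have hv5 := eq_vs_or_vs_iff (n + 2)
    simp only [mul_add, add_assoc, Nat.reduceMul, Nat.reduceAdd] at hu3 hu5 hv3 hv5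
    rw [edgesG, Set.mem_union, Set.mem_union, Set.mem_union, Set.mem_sdiff, ih]
    simp only [mem_block, mem_cyclic_block, mem_vertsG, hu3, hu5, hv3, hv5]
    push_cast
    by_cases hx : x.Valid <;> by_cases hy : y.Valid <;>
      simp only [hx, hy, true_and, false_and, and_false, or_self] <;> omega

theorem mem_vertsH (n : ℕ) (x : Label) :
    x ∈ vertsH (n + 1) ↔ x.Valid ∧ -(n + 1 : ℤ) ≤ x.cell ∧ x.cell ≤ n + 2 := by
  induction n with
  | zero =>
    cases x <;> simp [vertsH, Label.cell, Label.Valid] <;> omega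
  | succ n ih =>
    rw [vertsH, Set.mem_union, ih]
    cases x <;> simp [Label.cell, Label.Valid] <;> omega

/-- The edges of `𝓗_{n+1}` join cells that are consecutive on a cycle of `2 n + 4` cells, with the
positions `n + 2` and `-(n + 1)` at the two ends. -/
theorem mem_edgesH (n : ℕ) (x y : Label) :
    s(x, y) ∈ edgesH (n + 1) ↔ x ∈ vertsH (n + 1) ∧ y ∈ vertsH (n + 1) ∧
      (x.cell - y.cell = 1 ∨ y.cell - x.cell = 1 ∨
        x.cell - y.cell = 2 * n + 3 ∨ y.cell - x.cell = 2 * n + 3) := by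
  induction n with
  | zero =>
    have hu1 := eq_us_or_us_iff 0
    have hu3 := eq_us_or_us_iff 1
    have hv1 := eq_vs_or_vs_iff 0
    norm_num at hu1 hu3 hv1
    rw [edgesH, Set.mem_union, mem_star_block, mem_two_blocks, mem_vertsH, mem_vertsH]
    simp only [eq_u_or_v_iff, hu1, hu3, hv1]
    push_cast
    by_cases hx : x.Valid <;> by_cases hy : y.Valid <;>
      simp only [hx, hy, true_and, false_and, and_false, or_self] <;> omega
  | succ n ih =>
    have hu3 := eq_us_or_us_iff (n + 1)
    have hu5 := eq_us_or_us_iff (n + 2)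
    have hv1 := eq_vs_or_vs_iff n
    have hv3 := eq_vs_or_vs_iff (n + 1)
    simp only [mul_add, add_assoc, Nat.reduceMul, Nat.reduceAdd] at hu3 hu5 hv1 hv3
    rw [edgesH, Set.mem_union, Set.mem_union, Set.mem_union, Set.mem_sdiff, ih]
    simp only [mem_block, mem_vertsH, hu3, hu5, hv1, hv3]
    push_cast
    by_cases hx : x.Valid <;> by_cases hy : y.Valid <;>
      simp only [hx, hy, true_and, false_and, and_false, or_self] <;> omega

theorem Label.eq_of_cell_eq {x y : Label} (hx : x.Valid) (hy : y.Valid)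
    (h : x.cell = y.cell) (h' : x.side = y.side) : x = y := by
  cases x <;> cases y <;> simp [Label.cell, Label.side, Label.Valid] at * <;> omega

theorem Label.exists_cell_side (c : ℤ) (b : Bool) :
    ∃ x : Label, x.Valid ∧ x.cell = c ∧ x.side = b := by
  rcases lt_trichotomy c 0 with h | rfl | h
  · cases b
    · exact ⟨vs (2 * (-c).toNat - 1), ⟨by simp, by simp; omega⟩, by simp [Label.cell]; omega,
        by simp [Label.side]; omega⟩
    · exact ⟨vs (2 * (-c).toNat), ⟨by simp, by simp; omega⟩, by simp [Label.cell]; omega,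
        by simp [Label.side]⟩
  · cases b
    · exact ⟨u, by simp [Label.cell, Label.side, Label.Valid]⟩
    · exact ⟨v, by simp [Label.cell, Label.side, Label.Valid]⟩
  · cases b
    · exact ⟨us (2 * c.toNat - 1), ⟨by simp; omega, by simp⟩, by simp [Label.cell]; omega,
        by simp [Label.side]; omega⟩
    · exact ⟨us (2 * c.toNat), ⟨by simp; omega, by simp⟩, by simp [Label.cell]; omega,
        by simp [Label.side]⟩

/-- A graph on the labels whose cells fill an interval of `m = p + q + 1` integers around `0`, with
adjacency between cyclically consecutive cells, is the doubled cycle of length `m`. -/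
theorem nonempty_iso_doubleCycle_of_cells {s : Set Label} {E : Set (Sym2 Label)} {p q : ℕ}
    (hpq : 2 ≤ p + q)
    (hs : ∀ x, x ∈ s ↔ x.Valid ∧ -(p : ℤ) ≤ x.cell ∧ x.cell ≤ q)
    (hE : ∀ x y, s(x, y) ∈ E ↔ x ∈ s ∧ y ∈ s ∧ (x.cell - y.cell = 1 ∨ y.cell - x.cell = 1 ∨
      x.cell - y.cell = p + q ∨ y.cell - x.cell = p + q)) :
    Nonempty (doubleCycle (p + q + 1) ≃g (SimpleGraph.fromEdgeSet E).induce s) := by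
  have hb : ∀ x : s, -(p : ℤ) ≤ x.1.cell ∧ x.1.cell ≤ q := fun x => ((hs x.1).1 x.2).2
  have hn : ∀ x : s, x.1.Valid := fun x => ((hs x.1).1 x.2).1
  let f : s → Fin (p + q + 1) × Bool := fun x =>
    (⟨(x.1.cell + p).toNat, by have := hb x; omega⟩, x.1.side)
  have hf : Function.Bijective f := by
    constructor
    · intro x y hxy
      simp only [f, Prod.mk.injEq, Fin.mk.injEq] at hxy
      have h1 := hb x
      have h2 := hb y
      exact Subtype.ext (Label.eq_of_cell_eq (hn x) (hn y) (by omega) hxy.2)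
    · rintro ⟨i, b⟩
      obtain ⟨x, hx1, hx3, hx4⟩ := Label.exists_cell_side ((i.1 : ℤ) - p) b
      have := i.2
      refine ⟨⟨x, (hs x).2 ⟨hx1, by omega, by omega⟩⟩, ?_⟩
      simp only [f, Prod.mk.injEq]
      exact ⟨Fin.ext (by simp [hx3]), hx4⟩
  have e : (SimpleGraph.fromEdgeSet E).induce s ≃g doubleCycle (p + q + 1) :=
    { toEquiv := Equiv.ofBijective f hf
      map_rel_iff' := by
        intro x y
        have h1 := hb x
        have h2 := hb y
        have h3 : x.1 = y.1 → x.1.cell = y.1.cell := fun h => by rw [h]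
        simp only [Equiv.ofBijective_apply, doubleCycle, f, SimpleGraph.comap_adj,
          Function.Embedding.subtype_apply, SimpleGraph.fromEdgeSet_adj, hE, x.2, y.2, true_and,
          ne_eq, Fin.mk.injEq]
        constructor
        · intro h
          refine ⟨by omega, fun hxy => ?_⟩
          have := h3 hxy
          omega
        · rintro ⟨h, -⟩
          omega }
  exact ⟨e.symm⟩

theorem nonempty_iso_graphG (n : ℕ) : Nonempty (doubleCycle (2 * n + 5) ≃g graphG (n + 1)) := by
  have h := nonempty_iso_doubleCycle_of_cells (s := vertsG (n + 1)) (E := edgesG (n + 1))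
    (p := n + 2) (q := n + 2) (by omega) (fun x => by rw [mem_vertsG]; push_cast; rfl)
    (fun x y => by rw [mem_edgesG]; push_cast; ring_nf)
  rwa [show n + 2 + (n + 2) + 1 = 2 * n + 5 by ring] at h

theorem nonempty_iso_graphH (n : ℕ) : Nonempty (doubleCycle (2 * n + 4) ≃g graphH (n + 1)) := by
  have h := nonempty_iso_doubleCycle_of_cells (s := vertsH (n + 1)) (E := edgesH (n + 1))
    (p := n + 1) (q := n + 2) (by omega) (fun x => by rw [mem_vertsH]; push_cast; rfl)
    (fun x y => by rw [mem_edgesH]; push_cast; ring_nf)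
  rwa [show n + 1 + (n + 2) + 1 = 2 * n + 4 by ring] at h

theorem nonempty_iso_graphG₂ : Nonempty (doubleCycle 3 ≃g graphG₂) := by
  let f : Fin 3 × Bool → Fin 6 := fun x =>
    match x with
    | (0, false) => 0
    | (0, true) => 5
    | (1, false) => 1
    | (1, true) => 3
    | (2, false) => 2
    | (2, true) => 4
  refine ⟨{ toEquiv := Equiv.ofBijective f (by decide), map_rel_iff' := ?_ }⟩
  simp only [Equiv.ofBijective_apply, doubleCycle, graphG₂, SimpleGraph.fromEdgeSet_adj,
    Finset.mem_coe]
  intro a b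
  revert a b
  decide

/-- The doubled cycles of length at least `3` lie in `𝓕`: those of odd length at least `5` are the
graphs `𝓖_i`, those of even length the graphs `𝓗_j`, and the one of length `3` is `G₂`. -/
theorem memF_of_iso_doubleCycle {V : Type*} {G : SimpleGraph V} {m : ℕ} (hm : 3 ≤ m)
    (h : Nonempty (G ≃g doubleCycle m)) : MemF G := by
  obtain ⟨e⟩ := h
  obtain ⟨n, rfl | rfl⟩ : ∃ n, m = 2 * n + 3 ∨ m = 2 * n + 4 :=
    ⟨(m - 3) / 2, by omega⟩
  · cases n with
    | zero => exact Or.inr (Or.inl ⟨e.trans nonempty_iso_graphG₂.some⟩)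
    | succ n =>
      exact Or.inr (Or.inr (Or.inr (Or.inr (Or.inl
        ⟨n + 1, by omega, ⟨e.trans (nonempty_iso_graphG n).some⟩⟩))))
  · exact Or.inr (Or.inr (Or.inr (Or.inr (Or.inr
      ⟨n + 1, by omega, ⟨e.trans (nonempty_iso_graphH n).some⟩⟩))))

end Families

/-! ### Orthogonal signings -/

/-- A skew-symmetric signing of the edges of `G` with pairwise orthogonal rows. -/
structure OrthogonalSigning {V : Type*} [Fintype V] (G : SimpleGraph V) (s : V → V → ℝ) :
    Prop where
  swap : ∀ x y, s y x = -s x y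
  eq_one_or : ∀ x y, G.Adj x y → s x y = 1 ∨ s x y = -1
  eq_zero : ∀ x y, ¬ G.Adj x y → s x y = 0
  orthogonal : ∀ x y, x ≠ y → ∑ z, s x z * s y z = 0

section Signing

variable {V : Type*} [Fintype V] [DecidableEq V] {G : SimpleGraph V} [DecidableRel G.Adj]
  {s : V → V → ℝ}

namespace OrthogonalSigning

theorem sum_common (hs : OrthogonalSigning G s) {x y : V} (hxy : x ≠ y) :
    ∑ z ∈ G.neighborFinset x ∩ G.neighborFinset y, s x z * s y z = 0 := by
  rw [← hs.orthogonal x y hxy]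
  refine Finset.sum_subset (Finset.subset_univ _) fun z _ hz => ?_
  simp only [Finset.mem_inter, SimpleGraph.mem_neighborFinset, not_and_or] at hz
  rcases hz with h | h <;> simp [hs.eq_zero _ _ h]

theorem mul_eq_one_or {V : Type*} [Fintype V] {G : SimpleGraph V} {s : V → V → ℝ}
    (hs : OrthogonalSigning G s) {x y z : V} (hx : G.Adj x z)
    (hy : G.Adj y z) : s x z * s y z = 1 ∨ s x z * s y z = -1 := by
  rcases hs.eq_one_or _ _ hx with h | h <;> rcases hs.eq_one_or _ _ hy with h' | h' <;>
    simp [h, h']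

theorem even_card_common (hs : OrthogonalSigning G s) {x y : V} (hxy : x ≠ y) :
    Even (G.neighborFinset x ∩ G.neighborFinset y).card := by
  set C := G.neighborFinset x ∩ G.neighborFinset y with hC
  have h0 := hs.sum_common hxy
  have h1 : ∑ z ∈ C, s x z * s y z = ∑ z ∈ C, if s x z * s y z = 1 then (1 : ℝ) else -1 := by
    refine Finset.sum_congr rfl fun z hz => ?_
    simp only [hC, Finset.mem_inter, SimpleGraph.mem_neighborFinset] at hz
    rcases hs.mul_eq_one_or hz.1 hz.2 with h | h
    · simp [h]
    · rw [h]; norm_num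
  rw [← hC, h1, Finset.sum_ite] at h0
  simp only [Finset.sum_const, nsmul_eq_mul, mul_one, mul_neg] at h0
  have h2 := Finset.card_filter_add_card_filter_not (s := C) (fun z => s x z * s y z = 1)
  refine ⟨(C.filter fun z => s x z * s y z = 1).card, ?_⟩
  have h3 : (C.filter fun z => s x z * s y z = 1).card =
      (C.filter fun z => ¬ s x z * s y z = 1).card := by
    have : ((C.filter fun z => s x z * s y z = 1).card : ℝ) =
      (C.filter fun z => ¬ s x z * s y z = 1).card := by linarith
    exact_mod_cast this
  omega

theorem neighborFinset_eq_of_two_lt (hs : OrthogonalSigning G s) (hreg : G.IsRegularOfDegree 4)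
    {x y : V} (hxy : x ≠ y) (h : 2 < (G.neighborFinset x ∩ G.neighborFinset y).card) :
    G.neighborFinset x = G.neighborFinset y := by
  have hx : (G.neighborFinset x).card = 4 := hreg x
  have hy : (G.neighborFinset y).card = 4 := hreg y
  obtain ⟨k, hk⟩ := hs.even_card_common hxy
  have h1 := Finset.eq_of_subset_of_card_le
    (Finset.inter_subset_left (s₁ := G.neighborFinset x) (s₂ := G.neighborFinset y)) (by omega)
  have h2 := Finset.eq_of_subset_of_card_le
    (Finset.inter_subset_right (s₁ := G.neighborFinset x) (s₂ := G.neighborFinset y)) (by omega)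
  exact h1.symm.trans h2

/-- If `a` and `b` have two common neighbors at which their rows have the same product, then two
further common neighbors are needed to make the rows orthogonal, so `a` and `b` are twins. -/
theorem neighborFinset_eq_of_mul_eq_one (hs : OrthogonalSigning G s)
    (hreg : G.IsRegularOfDegree 4) {a b x y : V} (hab : a ≠ b) (hxy : x ≠ y)
    (hax : G.Adj a x) (hay : G.Adj a y) (hbx : G.Adj b x) (hby : G.Adj b y)
    (h : (s a x * s b x) * (s a y * s b y) = 1) :
    G.neighborFinset a = G.neighborFinset b := by
  have hsub : {x, y} ⊆ G.neighborFinset a ∩ G.neighborFinset b := by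
    intro z hz
    simp only [Finset.mem_insert, Finset.mem_singleton] at hz
    rcases hz with rfl | rfl <;> simp [*]
  have hcard : ({x, y} : Finset V).card = 2 := Finset.card_pair hxy
  by_contra hne
  have h1 : ¬ 2 < (G.neighborFinset a ∩ G.neighborFinset b).card :=
    fun h => hne (hs.neighborFinset_eq_of_two_lt hreg hab h)
  have h2 := Finset.eq_of_subset_of_card_le hsub (by omega)
  have h3 := hs.sum_common hab
  rw [← h2, Finset.sum_pair hxy] at h3
  rcases hs.mul_eq_one_or hax hbx with h4 | h4 <;> rw [h4] at h h3 <;> nlinarith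

end OrthogonalSigning

/-! ### Twins: the doubled cycles -/

/-- Two pairs of twins `x, y` and `a, b`, completely joined to each other, for which the four
signs between them multiply to `1`. -/
structure IsTwinSquare (G : SimpleGraph V) [DecidableRel G.Adj] (s : V → V → ℝ)
    (x y a b : V) : Prop where
  ne_left : x ≠ y
  ne_right : a ≠ b
  twin_left : G.neighborFinset x = G.neighborFinset y
  twin_right : G.neighborFinset a = G.neighborFinset b
  adj : G.Adj a x
  sign : (s a x * s b x) * (s a y * s b y) = 1

theorem adj_iff_of_twin {V : Type*} [Fintype V] {G : SimpleGraph V} [DecidableRel G.Adj] {a b : V}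
    (h : G.neighborFinset a = G.neighborFinset b) (z : V) :
    G.Adj a z ↔ G.Adj b z := by
  rw [← SimpleGraph.mem_neighborFinset, h, SimpleGraph.mem_neighborFinset]

/-- Twins `a`, `b` whose rows have the same product at the twins `x`, `y` have the opposite product
at the two remaining neighbors `z`, `w`, so that these are twins as well. -/
theorem IsTwinSquare.step (hs : OrthogonalSigning G s) (hreg : G.IsRegularOfDegree 4)
    {x y a b : V} (h : IsTwinSquare G s x y a b) :
    ∃ z w, IsTwinSquare G s a b z w ∧ z ≠ x ∧ z ≠ y ∧ w ≠ x ∧ w ≠ y ∧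
      ∀ v, G.Adj a v ↔ v = x ∨ v = y ∨ v = z ∨ v = w := by
  have ha : (G.neighborFinset a).card = 4 := hreg a
  have hax : G.Adj a x := h.adj
  have hay : G.Adj a y := ((adj_iff_of_twin h.twin_left a).1 hax.symm).symm
  have hsub : {x, y} ⊆ G.neighborFinset a := by
    intro z hz
    simp only [Finset.mem_insert, Finset.mem_singleton] at hz
    rcases hz with rfl | rfl <;> simp [*]
  have hcard : (G.neighborFinset a \ {x, y}).card = 2 := by
    rw [Finset.card_sdiff_of_subset hsub, ha, Finset.card_pair h.ne_left]
  obtain ⟨z, w, hzw, hzw'⟩ := Finset.card_eq_two.1 hcard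
  have hz : z ∈ G.neighborFinset a \ {x, y} := by rw [hzw']; simp
  have hw : w ∈ G.neighborFinset a \ {x, y} := by rw [hzw']; simp
  simp only [Finset.mem_sdiff, SimpleGraph.mem_neighborFinset, Finset.mem_insert,
    Finset.mem_singleton, not_or] at hz hw
  obtain ⟨haz, hzx, hzy⟩ := hz
  obtain ⟨haw, hwx, hwy⟩ := hw
  have hN : G.neighborFinset a = {x, y, z, w} := by
    rw [← Finset.union_sdiff_of_subset hsub, hzw']
    ext v
    simp only [Finset.mem_union, Finset.mem_insert, Finset.mem_singleton, or_assoc]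
  have hb := adj_iff_of_twin h.twin_right
  have hsum := hs.sum_common h.ne_right
  rw [← h.twin_right, Finset.inter_self, hN, Finset.sum_insert (by
    simp [h.ne_left, Ne.symm hzx, Ne.symm hwx]),
    Finset.sum_insert (by simp [Ne.symm hzy, Ne.symm hwy]), Finset.sum_pair hzw] at hsum
  have hsign : (s a z * s b z) * (s a w * s b w) = 1 := by
    have h1 := h.sign
    rcases hs.mul_eq_one_or hax ((hb x).1 hax) with h2 | h2 <;>
    rcases hs.mul_eq_one_or hay ((hb y).1 hay) with h3 | h3 <;>
    rcases hs.mul_eq_one_or haz ((hb z).1 haz) with h4 | h4 <;>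
    rcases hs.mul_eq_one_or haw ((hb w).1 haw) with h5 | h5 <;>
    (rw [h2, h3] at h1; rw [h2, h3, h4, h5] at hsum; rw [h4, h5]; linarith)
  have hsign' : (s z a * s w a) * (s z b * s w b) = 1 := by
    rw [hs.swap a z, hs.swap a w, hs.swap b z, hs.swap b w]
    linarith
  refine ⟨z, w, ⟨h.ne_right, hzw, h.twin_right, ?_, haz.symm, hsign'⟩, hzx, hzy, hwx, hwy, ?_⟩
  · exact hs.neighborFinset_eq_of_mul_eq_one hreg hzw h.ne_right haz.symm ((hb z).1 haz).symm
      haw.symm ((hb w).1 haw).symm hsign'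
  · intro v
    rw [← SimpleGraph.mem_neighborFinset, hN]
    simp

/-- A pair of twins extends to a twin square: their rows have the same product at two of their
four common neighbors. -/
theorem exists_isTwinSquare (hs : OrthogonalSigning G s) (hreg : G.IsRegularOfDegree 4)
    {x y : V} (hxy : x ≠ y) (h : G.neighborFinset x = G.neighborFinset y) :
    ∃ a b, IsTwinSquare G s x y a b := by
  have hx : (G.neighborFinset x).card = 4 := hreg x
  have hy := adj_iff_of_twin h
  have key : ∃ a b, a ≠ b ∧ G.Adj x a ∧ G.Adj x b ∧ (s x a * s y a) * (s x b * s y b) = 1 := by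
    obtain ⟨a, b, c, ha, hb, hc, hab, hac, hbc⟩ :=
      Finset.two_lt_card_iff.1 (show 2 < (G.neighborFinset x).card by omega)
    rw [SimpleGraph.mem_neighborFinset] at ha hb hc
    have h1 := hs.mul_eq_one_or ha ((hy a).1 ha)
    have h2 := hs.mul_eq_one_or hb ((hy b).1 hb)
    have h3 := hs.mul_eq_one_or hc ((hy c).1 hc)
    by_cases h12 : s x a * s y a = s x b * s y b
    · refine ⟨a, b, hab, ha, hb, ?_⟩
      rw [← h12]; rcases h1 with h | h <;> rw [h] <;> norm_num
    by_cases h13 : s x a * s y a = s x c * s y c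
    · refine ⟨a, c, hac, ha, hc, ?_⟩
      rw [← h13]; rcases h1 with h | h <;> rw [h] <;> norm_num
    refine ⟨b, c, hbc, hb, hc, ?_⟩
    rcases h1 with h1 | h1 <;> rcases h2 with h2 | h2 <;> rcases h3 with h3 | h3 <;>
      simp_all
  obtain ⟨a, b, hab, ha, hb, hsign⟩ := key
  have hsign' : (s a x * s b x) * (s a y * s b y) = 1 := by
    rw [hs.swap x a, hs.swap x b, hs.swap y a, hs.swap y b]
    linarith
  exact ⟨a, b, hxy, hab, h, hs.neighborFinset_eq_of_mul_eq_one hreg hab hxy ha.symm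
    ((hy a).1 ha).symm hb.symm ((hy b).1 hb).symm hsign', ha.symm, hsign'⟩

/-- Repeating the step from a twin square to the next one yields a sequence of pairs of vertices,
each of which has the two adjacent pairs of the sequence as its neighborhood. -/
theorem exists_pair_sequence (hs : OrthogonalSigning G s) (hreg : G.IsRegularOfDegree 4)
    {x y a b : V} (h : IsTwinSquare G s x y a b) :
    ∃ P : ℕ → Bool → V, (∀ n, Function.Injective (P n)) ∧
      (∀ n b c, P n b ≠ P (n + 2) c) ∧
      ∀ n b v, G.Adj (P (n + 1) b) v ↔ (∃ c, v = P n c) ∨ ∃ c, v = P (n + 2) c := by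
  let S := {q : V × V × V × V // IsTwinSquare G s q.1 q.2.1 q.2.2.1 q.2.2.2}
  have hstep : ∀ q : S, ∃ r : S, r.1.1 = q.1.2.2.1 ∧ r.1.2.1 = q.1.2.2.2 ∧
      r.1.2.2.1 ≠ q.1.1 ∧ r.1.2.2.1 ≠ q.1.2.1 ∧ r.1.2.2.2 ≠ q.1.1 ∧ r.1.2.2.2 ≠ q.1.2.1 ∧
      ∀ v, G.Adj q.1.2.2.1 v ↔
        v = q.1.1 ∨ v = q.1.2.1 ∨ v = r.1.2.2.1 ∨ v = r.1.2.2.2 := by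
    rintro ⟨⟨x, y, a, b⟩, hq⟩
    obtain ⟨z, w, h1, h2⟩ := IsTwinSquare.step hs hreg hq
    exact ⟨⟨⟨a, b, z, w⟩, h1⟩, rfl, rfl, h2⟩
  choose nxt h1 h2 h3 h4 h5 h6 h7 using hstep
  let q : ℕ → S := fun n => nxt^[n] ⟨⟨x, y, a, b⟩, h⟩
  have hq : ∀ n, q (n + 1) = nxt (q n) := fun n => Function.iterate_succ_apply' _ _ _
  have e1 : ∀ n, (q (n + 1)).1.1 = (q n).1.2.2.1 := fun n => by rw [hq, h1]
  have e2 : ∀ n, (q (n + 1)).1.2.1 = (q n).1.2.2.2 := fun n => by rw [hq, h2]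
  have e3 : ∀ n, (q (n + 2)).1.1 = (nxt (q n)).1.2.2.1 := fun n => by rw [e1, hq]
  have e4 : ∀ n, (q (n + 2)).1.2.1 = (nxt (q n)).1.2.2.2 := fun n => by rw [e2, hq]
  refine ⟨fun n b => bif b then (q n).1.2.1 else (q n).1.1, ?_, ?_, ?_⟩
  · intro n b c hbc
    have := (q n).2.ne_left
    cases b <;> cases c <;> simp_all
  · intro n b c
    have := h3 (q n)
    have := h4 (q n)
    have := h5 (q n)
    have := h6 (q n)
    cases b <;> cases c <;> simp only [cond_true, cond_false, e3, e4] <;> tauto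
  · intro n b v
    have hb : G.Adj (bif b then (q (n + 1)).1.2.1 else (q (n + 1)).1.1) v ↔
        G.Adj (q n).1.2.2.1 v := by
      cases b
      · rw [cond_false, e1]
      · rw [cond_true, e2]
        exact (adj_iff_of_twin (q n).2.twin_right v).symm
    rw [hb, h7]
    simp only [Bool.exists_bool, cond_true, cond_false, e3, e4]
    tauto

/-- A sequence of pairs as in `exists_pair_sequence` closes up to a doubled cycle, namely at the
first pair that meets an earlier one. -/
theorem exists_iso_doubleCycle_of_pair_sequence {V : Type*} [Finite V] {G : SimpleGraph V}
    (hconn : G.Connected) {P : ℕ → Bool → V}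
    (hinj : ∀ n, Function.Injective (P n)) (hne : ∀ n b c, P n b ≠ P (n + 2) c)
    (hadj : ∀ n b v, G.Adj (P (n + 1) b) v ↔ (∃ c, v = P n c) ∨ ∃ c, v = P (n + 2) c) :
    ∃ m, 3 ≤ m ∧ Nonempty (G ≃g doubleCycle m) := by
  classical
  have hne1 : ∀ n b c, P n b ≠ P (n + 1) c := fun n b c h =>
    (((hadj n c (P n b)).2 (Or.inl ⟨b, rfl⟩)).ne h.symm)
  -- The pair with index `0` is left out, so that every pair considered has a predecessor.
  have hex : ∃ k j, 1 ≤ j ∧ j < k ∧ ∃ b c, P k b = P j c := by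
    obtain ⟨i, j, hij, h⟩ := Finite.exists_ne_map_eq_of_infinite fun n : ℕ => P (n + 1) true
    rcases lt_or_gt_of_ne hij with hlt | hlt
    · exact ⟨j + 1, i + 1, by omega, by omega, true, true, h.symm⟩
    · exact ⟨i + 1, j + 1, by omega, by omega, true, true, h⟩
  obtain ⟨j, hj1, hjk, b₀, c₀, hkj⟩ := Nat.find_spec hex
  have hmin : ∀ i i', 1 ≤ i' → i' < i → i < Nat.find hex → ∀ b c, P i b ≠ P i' c :=
    fun i i' h1 h2 h3 b c h => Nat.find_min hex h3 ⟨i', h1, h2, b, c, h⟩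
  generalize Nat.find hex = k at hjk hkj hmin
  obtain ⟨m, rfl⟩ : ∃ m, k = m + 1 := ⟨k - 1, by omega⟩
  obtain ⟨j, rfl⟩ : ∃ i, j = i + 1 := ⟨j - 1, by omega⟩
  have hj2 : j + 1 ≠ m := by rintro rfl; exact hne1 _ _ _ hkj.symm
  have hj3 : j + 2 ≠ m := by rintro rfl; exact hne _ _ _ hkj.symm
  have hPm : ∀ b, (∃ c, P m b = P j c) ∨ ∃ c, P m b = P (j + 2) c := fun b => by
    rw [← hadj j c₀, ← hkj, hadj m b₀]
    exact Or.inl ⟨b, rfl⟩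
  have hj0 : j = 0 := by
    by_contra h0
    rcases hPm true with ⟨c, hc⟩ | ⟨c, hc⟩
    · exact hmin m j (by omega) (by omega) (by omega) _ _ hc
    · exact hmin m (j + 2) (by omega) (by omega) (by omega) _ _ hc
  subst hj0
  have hP0 : ∀ b, ∃ c, P m b = P 0 c := fun b => by
    rcases hPm b with h | ⟨c, hc⟩
    · exact h
    · exact absurd hc (hmin m 2 (by omega) (by omega) (by omega) _ _)
  have flip : ∀ {f g : Bool → V}, Function.Injective f → (∀ b, ∃ c, f b = g c) →
      ∀ b, ∃ c, g b = f c := by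
    intro f g hf hfg b
    choose t ht using hfg
    have htinj : Function.Injective t := fun a a' h => hf (by rw [ht, ht, h])
    obtain ⟨c, hc⟩ := Finite.surjective_of_injective htinj b
    exact ⟨c, by rw [ht, hc]⟩
  have hP0' := flip (hinj m) hP0
  have hP1 : ∀ b, ∃ c, P 1 b = P (m + 1) c := fun b => by
    obtain ⟨m, rfl⟩ : ∃ i, m = i + 1 := ⟨m - 1, by omega⟩
    have h : G.Adj (P (m + 1) true) (P 1 b) := by
      obtain ⟨c, hc⟩ := hP0 true
      rw [hc]
      exact ((hadj 0 b (P 0 c)).2 (Or.inl ⟨c, rfl⟩)).symm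
    rcases (hadj m true _).1 h with ⟨c, hc⟩ | h
    · exact absurd hc.symm (hmin m 1 (by omega) (by omega) (by omega) _ _)
    · exact h
  have hP1' := flip (hinj 1) hP1
  refine ⟨m, by omega, ?_⟩
  let f : Fin m × Bool → V := fun x => P (x.1.1 + 1) x.2
  have hne0 : Nonempty (Fin m × Bool) := ⟨⟨⟨0, by omega⟩, true⟩⟩
  have lift : ∀ i v, G.Adj (f i) v → ∃ j, (doubleCycle m).Adj i j ∧ f j = v := by
    rintro ⟨⟨i, hi⟩, b⟩ v hv
    rcases (hadj i b v).1 hv with ⟨c, hc⟩ | ⟨c, hc⟩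
    · cases i with
      | zero =>
        obtain ⟨d, hd⟩ := hP0' c
        refine ⟨⟨⟨m - 1, by omega⟩, d⟩, by simp [doubleCycle]; omega, ?_⟩
        simp only [f]
        rw [hc, hd, Nat.sub_add_cancel (by omega)]
      | succ i => exact ⟨⟨⟨i, by omega⟩, c⟩, by simp [doubleCycle], hc.symm⟩
    · by_cases him : i + 1 = m
      · subst him
        obtain ⟨d, hd⟩ := hP1' c
        exact ⟨⟨⟨0, by omega⟩, d⟩, by simp [doubleCycle]; omega, by rw [hc, hd]⟩
      · exact ⟨⟨⟨i + 1, by omega⟩, c⟩, by simp [doubleCycle], hc.symm⟩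
  have hom : ∀ i j, (doubleCycle m).Adj i j → G.Adj (f i) (f j) := by
    have hsucc : ∀ n b c, G.Adj (P n b) (P (n + 1) c) := fun n b c =>
      ((hadj n c _).2 (Or.inl ⟨b, rfl⟩)).symm
    have hlast : ∀ b c, G.Adj (P 1 b) (P m c) := fun b c => by
      obtain ⟨d, hd⟩ := hP0 c
      rw [hd]
      exact (hsucc 0 d b).symm
    rintro ⟨⟨i, hi⟩, b⟩ ⟨⟨j, hj⟩, c⟩ h
    simp only [doubleCycle, f] at h ⊢
    rcases h with rfl | rfl | ⟨-, h | h⟩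
    · exact hsucc _ _ _
    · exact (hsucc _ _ _).symm
    · obtain rfl : i = 0 := by omega
      obtain rfl : m = j + 1 := by omega
      exact hlast _ _
    · obtain rfl : j = 0 := by omega
      obtain rfl : m = i + 1 := by omega
      exact (hlast _ _).symm
  have hfinj : Function.Injective f := by
    rintro ⟨⟨i, hi⟩, b⟩ ⟨⟨j, hj⟩, c⟩ h
    simp only [f] at h
    rcases lt_trichotomy i j with hij | rfl | hij
    · exact absurd h.symm (hmin _ _ (by omega) (by omega) (by omega) _ _)
    · rw [hinj _ h]
    · exact absurd h (hmin _ _ (by omega) (by omega) (by omega) _ _)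
  exact nonempty_iso_of_lift hconn hfinj hom lift

/-- A graph with twins is a doubled cycle. -/
theorem memF_of_twins (hs : OrthogonalSigning G s) (hconn : G.Connected)
    (hreg : G.IsRegularOfDegree 4) {x y : V} (hxy : x ≠ y)
    (h : G.neighborFinset x = G.neighborFinset y) : MemF G := by
  obtain ⟨a, b, hsq⟩ := exists_isTwinSquare hs hreg hxy h
  obtain ⟨P, h1, h2, h3⟩ := exists_pair_sequence hs hreg hsq
  obtain ⟨m, hm, e⟩ := exists_iso_doubleCycle_of_pair_sequence hconn h1 h2 h3
  exact memF_of_iso_doubleCycle hm e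

end Signing

/-! ### Graphs without twins -/

/-- Any two distinct vertices have none or exactly two common neighbors. -/
structure HasNoneOrTwoCommon {V : Type*} (G : SimpleGraph V) : Prop where
  exists_other : ∀ x y a, x ≠ y → G.Adj x a → G.Adj y a → ∃ b, b ≠ a ∧ G.Adj x b ∧ G.Adj y b
  at_most_two : ∀ x y a b c, x ≠ y → G.Adj x a → G.Adj x b → G.Adj x c →
    G.Adj y a → G.Adj y b → G.Adj y c → a ≠ b → a ≠ c → b ≠ c → False

theorem OrthogonalSigning.hasNoneOrTwoCommon {V : Type*} [Fintype V] [DecidableEq V]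
    {G : SimpleGraph V} [DecidableRel G.Adj] {s : V → V → ℝ} (hs : OrthogonalSigning G s)
    (hreg : G.IsRegularOfDegree 4)
    (h : ∀ x y, x ≠ y → G.neighborFinset x ≠ G.neighborFinset y) : HasNoneOrTwoCommon G := by
  constructor
  · intro x y a hxy hxa hya
    have ha : a ∈ G.neighborFinset x ∩ G.neighborFinset y := by simp [hxa, hya]
    obtain ⟨k, hk⟩ := hs.even_card_common hxy
    have hpos := Finset.card_pos.2 ⟨a, ha⟩
    obtain ⟨b, hb, hba⟩ := Finset.exists_mem_ne
      (show 1 < (G.neighborFinset x ∩ G.neighborFinset y).card by omega) a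
    simp only [Finset.mem_inter, SimpleGraph.mem_neighborFinset] at hb
    exact ⟨b, hba, hb.1, hb.2⟩
  · intro x y a b c hxy h1 h2 h3 h4 h5 h6 hab hac hbc
    refine h x y hxy (hs.neighborFinset_eq_of_two_lt hreg hxy ?_)
    exact Finset.two_lt_card.2 ⟨a, by simp [*], b, by simp [*], c, by simp [*], hab, hac, hbc⟩

theorem exists_fourth_neighbor {V : Type*} [Fintype V] [DecidableEq V] {G : SimpleGraph V}
    [DecidableRel G.Adj] (hreg : G.IsRegularOfDegree 4) {x a b c : V} (ha : G.Adj x a)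
    (hb : G.Adj x b) (hc : G.Adj x c) (hab : a ≠ b) (hac : a ≠ c) (hbc : b ≠ c) :
    ∃ d, d ≠ a ∧ d ≠ b ∧ d ≠ c ∧ ∀ v, G.Adj x v ↔ v = a ∨ v = b ∨ v = c ∨ v = d := by
  have hsub : {a, b, c} ⊆ G.neighborFinset x := by
    intro z hz
    simp only [Finset.mem_insert, Finset.mem_singleton] at hz
    rcases hz with rfl | rfl | rfl <;> simp [*]
  have hx : (G.neighborFinset x).card = 4 := hreg x
  have hcard : (G.neighborFinset x \ {a, b, c}).card = 1 := by
    rw [Finset.card_sdiff_of_subset hsub, hx, Finset.card_eq_three.2 ⟨a, b, c, hab, hac, hbc, rfl⟩]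
  obtain ⟨d, hd⟩ := Finset.card_eq_one.1 hcard
  have hd' : d ∈ G.neighborFinset x \ {a, b, c} := by rw [hd]; simp
  simp only [Finset.mem_sdiff, SimpleGraph.mem_neighborFinset, Finset.mem_insert,
    Finset.mem_singleton, not_or] at hd'
  refine ⟨d, hd'.2.1, hd'.2.2.1, hd'.2.2.2, fun v => ?_⟩
  rw [← SimpleGraph.mem_neighborFinset, ← Finset.union_sdiff_of_subset hsub, hd]
  simp only [Finset.mem_union, Finset.mem_insert, Finset.mem_singleton, or_assoc]

/-- An injective map from the vertices of a `4`-regular graph, given by a list of edges, to those of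
a connected `4`-regular graph that sends edges to edges is an isomorphism. -/
theorem nonempty_iso_fromEdgeSet {V : Type*} [Fintype V] [DecidableEq V] {G : SimpleGraph V}
    [DecidableRel G.Adj] (hconn : G.Connected) (hreg : G.IsRegularOfDegree 4) {n : ℕ} [NeZero n]
    {E : Finset (Sym2 (Fin n))}
    (hE : ∀ i : Fin n, (Finset.univ.filter fun j => s(i, j) ∈ E ∧ i ≠ j).card = 4)
    {f : Fin n → V} (hf : (List.ofFn f).Nodup) (hom : ∀ e ∈ E, e.map f ∈ G.edgeSet) :
    Nonempty (G ≃g SimpleGraph.fromEdgeSet (E : Set (Sym2 (Fin n)))) := by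
  classical
  refine nonempty_iso_of_regular hconn hreg (fun i => ?_) (List.nodup_ofFn.1 hf) fun i j hij => ?_
  · rw [← SimpleGraph.card_neighborFinset_eq_degree, SimpleGraph.neighborFinset_eq_filter, ← hE i]
    congr 1
  · have h := hom s(i, j) (by simpa using hij.1)
    simpa using h

section Triangle

variable {V : Type*} {G : SimpleGraph V}

/-- In a complete graph on `p, q, r, t`, the fourth neighbors `p'` of `p` and `q'` of `q` are
distinct and adjacent. -/
theorem HasNoneOrTwoCommon.outer_adj (h : HasNoneOrTwoCommon G) {p q r t p' q' : V}
    (hpq : G.Adj p q) (hpr : G.Adj p r) (hpt : G.Adj p t) (hqr : G.Adj q r) (hqt : G.Adj q t)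
    (hrt : G.Adj r t) (hp' : G.Adj p p') (hp'q : p' ≠ q) (hp'r : p' ≠ r) (hp't : p' ≠ t)
    (hq' : ∀ v, G.Adj q v ↔ v = p ∨ v = r ∨ v = t ∨ v = q') :
    p' ≠ q' ∧ G.Adj p' q' := by
  refine ⟨?_, ?_⟩
  · rintro rfl
    exact h.at_most_two p q r t p' hpq.ne hpr hpt hp' hqr hqt ((hq' _).2 (by simp)) hrt.ne
      hp'r.symm hp't.symm
  · obtain ⟨e, hep, hpe, hqe⟩ := h.exists_other p' q p hp'q hp'.symm hpq.symm
    rcases (hq' e).1 hqe with rfl | rfl | rfl | rfl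
    · exact absurd rfl hep
    · exact (h.at_most_two p e q t p' hpr.ne hpq hpt hp' hqr.symm hrt hpe.symm hqt.ne
        hp'q.symm hp't.symm).elim
    · exact (h.at_most_two p e q r p' hpt.ne hpq hpr hp' hqt.symm hrt.symm hpe.symm hqr.ne
        hp'q.symm hp'r.symm).elim
    · exact hpe

/-- Without twins, every triangle lies in a complete subgraph of order four. -/
theorem HasNoneOrTwoCommon.exists_complete [Fintype V] [DecidableEq V] [DecidableRel G.Adj]
    (h : HasNoneOrTwoCommon G) (hreg : G.IsRegularOfDegree 4) {x a b : V}
    (hxa : G.Adj x a) (hxb : G.Adj x b) (hab : G.Adj a b) :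
    ∃ c, G.Adj x c ∧ G.Adj a c ∧ G.Adj b c := by
  obtain ⟨c, hcb, hxc, hac⟩ := h.exists_other x a b hxa.ne hxb hab
  obtain ⟨d, hda, hdb, hdc, hd⟩ := exists_fourth_neighbor hreg hxa hxb hxc hab.ne hac.ne hcb.symm
  have hxd : G.Adj x d := (hd d).2 (by simp)
  obtain ⟨e, hea, hxe, hbe⟩ := h.exists_other x b a hxb.ne hxa hab.symm
  rcases (hd e).1 hxe with rfl | rfl | rfl | rfl
  · exact absurd rfl hea
  · exact absurd rfl hbe.ne
  · exact ⟨e, hxe, hac, hbe⟩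
  · -- Here `b ≁ c`, and the second common neighbor `f` of `x` and `e` is `a` or `c`; then
    -- `x, a` or `a, e` have three common neighbors.
    obtain ⟨f, hfb, hxf, hef⟩ := h.exists_other x e b hxe.ne hxb hbe.symm
    rcases (hd f).1 hxf with rfl | rfl | rfl | rfl
    · exact (h.at_most_two x f b c e hxf.ne hxb hxc hxe hab hac hef.symm hcb.symm hdb.symm
        hdc.symm).elim
    · exact absurd rfl hfb
    · exact (h.at_most_two a e x b f hda.symm hxa.symm hab hac hxe.symm hbe.symm hef hxb.ne hxf.ne
        hcb.symm).elim
    · exact absurd rfl hef.ne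

/-- A graph with a triangle but without twins is `G₁`. -/
theorem HasNoneOrTwoCommon.nonempty_iso_graphG₁ [Fintype V] [DecidableEq V] [DecidableRel G.Adj]
    (h : HasNoneOrTwoCommon G) (hconn : G.Connected) (hreg : G.IsRegularOfDegree 4) {x a b : V}
    (hxa : G.Adj x a) (hxb : G.Adj x b) (hab : G.Adj a b) : Nonempty (G ≃g graphG₁) := by
  obtain ⟨c, hxc, hac, hbc⟩ := h.exists_complete hreg hxa hxb hab
  obtain ⟨x', x1, x2, x3, hx⟩ := exists_fourth_neighbor hreg hxa hxb hxc hab.ne hac.ne hbc.ne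
  obtain ⟨a', a1, a2, a3, ha⟩ :=
    exists_fourth_neighbor hreg hxa.symm hab hac hxb.ne hxc.ne hbc.ne
  obtain ⟨b', b1, b2, b3, hb⟩ :=
    exists_fourth_neighbor hreg hxb.symm hab.symm hbc hxa.ne hxc.ne hac.ne
  obtain ⟨c', c1, c2, c3, hc⟩ :=
    exists_fourth_neighbor hreg hxc.symm hac.symm hbc.symm hxa.ne hxb.ne hab.ne
  have hxx : G.Adj x x' := (hx x').2 (by simp)
  have haa : G.Adj a a' := (ha a').2 (by simp)
  have hbb : G.Adj b b' := (hb b').2 (by simp)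
  have hcc : G.Adj c c' := (hc c').2 (by simp)
  have hxa' := h.outer_adj hxa hxb hxc hab hac hbc hxx x1 x2 x3 ha
  have hxb' := h.outer_adj hxb hxa hxc hab.symm hbc hac hxx x2 x1 x3 hb
  have hxc' := h.outer_adj hxc hxa hxb hac.symm hbc.symm hab hxx x3 x1 x2 hc
  have hab' := h.outer_adj hab hxa.symm hac hxb.symm hbc hxc haa a2 a1 a3 (q' := b')
    (by intro v; rw [hb]; tauto)
  have hac' := h.outer_adj hac hxa.symm hab hxc.symm hbc.symm hxb haa a3 a1 a2 (q' := c')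
    (by intro v; rw [hc]; tauto)
  have hbc' := h.outer_adj hbc hxb.symm hab.symm hxc.symm hac.symm hxa hbb b3 b1 b2 (q' := c')
    (by intro v; rw [hc]; tauto)
  refine nonempty_iso_fromEdgeSet hconn hreg (E := edgesG₁) (by decide)
    (f := ![x, a, b, c, x', a', b', c']) ?_ ?_
  · simp only [List.ofFn_succ, List.ofFn_zero, List.nodup_cons, List.mem_cons, List.not_mem_nil,
      or_false, not_or, Matrix.cons_val_zero, Matrix.cons_val_succ, List.nodup_nil, and_true,
      not_false_eq_true]
    exact ⟨⟨hxa.ne, hxb.ne, hxc.ne, hxx.ne, a1.symm, b1.symm, c1.symm⟩,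
      ⟨hab.ne, hac.ne, x1.symm, haa.ne, b2.symm, c2.symm⟩,
      ⟨hbc.ne, x2.symm, a2.symm, hbb.ne, c3.symm⟩,
      ⟨x3.symm, a3.symm, b3.symm, hcc.ne⟩,
      ⟨hxa'.1, hxb'.1, hxc'.1⟩, ⟨hab'.1, hac'.1⟩, hbc'.1⟩
  · simp only [edgesG₁, Finset.forall_mem_insert, Finset.mem_singleton, forall_eq, Sym2.map_mk,
      SimpleGraph.mem_edgeSet]
    exact ⟨hxa, hxb, hxc, hab, hac, hbc, hxa'.2, hxb'.2, hxc'.2, hab'.2, hac'.2, hbc'.2,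
      hxx, haa, hbb, hcc⟩

end Triangle

/-! ### Triangle-free graphs without twins -/

section TriangleFree

variable {V : Type*} {G : SimpleGraph V}

/-- The neighbors of `x` are the four distinct vertices `a`, `b`, `c`, `d`. -/
structure IsNbhd (G : SimpleGraph V) (x a b c d : V) : Prop where
  ab : a ≠ b
  ac : a ≠ c
  ad : a ≠ d
  bc : b ≠ c
  bd : b ≠ d
  cd : c ≠ d
  adj_iff : ∀ v, G.Adj x v ↔ v = a ∨ v = b ∨ v = c ∨ v = d

namespace IsNbhd

variable {x a b c d : V}

theorem swap_ab (e : IsNbhd G x a b c d) : IsNbhd G x b a c d :=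
  ⟨e.ab.symm, e.bc, e.bd, e.ac, e.ad, e.cd, fun v => by rw [e.adj_iff]; tauto⟩

theorem swap_bc (e : IsNbhd G x a b c d) : IsNbhd G x a c b d :=
  ⟨e.ac, e.ab, e.ad, e.bc.symm, e.cd, e.bd, fun v => by rw [e.adj_iff]; tauto⟩

theorem swap_cd (e : IsNbhd G x a b c d) : IsNbhd G x a b d c :=
  ⟨e.ab, e.ad, e.ac, e.bd, e.bc, e.cd.symm, fun v => by rw [e.adj_iff]; tauto⟩

theorem adj_a (e : IsNbhd G x a b c d) : G.Adj x a := (e.adj_iff a).2 (by simp)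

theorem adj_b (e : IsNbhd G x a b c d) : G.Adj x b := (e.adj_iff b).2 (by simp)

theorem adj_c (e : IsNbhd G x a b c d) : G.Adj x c := (e.adj_iff c).2 (by simp)

theorem adj_d (e : IsNbhd G x a b c d) : G.Adj x d := (e.adj_iff d).2 (by simp)

end IsNbhd

theorem exists_isNbhd [Fintype V] [DecidableEq V] [DecidableRel G.Adj]
    (hreg : G.IsRegularOfDegree 4) (x : V) : ∃ a b c d, IsNbhd G x a b c d := by
  have hx : (G.neighborFinset x).card = 4 := hreg x
  obtain ⟨a, b, c, ha, hb, hc, hab, hac, hbc⟩ :=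
    Finset.two_lt_card_iff.1 (show 2 < (G.neighborFinset x).card by omega)
  rw [SimpleGraph.mem_neighborFinset] at ha hb hc
  obtain ⟨d, hda, hdb, hdc, hd⟩ := exists_fourth_neighbor hreg ha hb hc hab hac hbc
  exact ⟨a, b, c, d, hab, hac, hda.symm, hbc, hdb.symm, hdc.symm, hd⟩

/-- `y a b` is the common neighbor other than `x` of the neighbors `a` and `b` of `x`. -/
def IsOpposite (G : SimpleGraph V) (x : V) (y : V → V → V) : Prop :=
  ∀ a b, G.Adj x a → G.Adj x b → a ≠ b → ∀ v, (v ≠ x ∧ G.Adj a v ∧ G.Adj b v) ↔ v = y a b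

theorem HasNoneOrTwoCommon.exists_isOpposite (h : HasNoneOrTwoCommon G) (x : V) :
    ∃ y, IsOpposite G x y := by
  have key : ∀ a b, ∃ w, G.Adj x a → G.Adj x b → a ≠ b →
      ∀ v, (v ≠ x ∧ G.Adj a v ∧ G.Adj b v) ↔ v = w := by
    intro a b
    by_cases hab : G.Adj x a ∧ G.Adj x b ∧ a ≠ b
    · obtain ⟨ha, hb, hne⟩ := hab
      obtain ⟨w, hwx, haw, hbw⟩ := h.exists_other a b x hne ha.symm hb.symm
      refine ⟨w, fun _ _ _ v => ⟨fun ⟨h1, h2, h3⟩ => ?_, fun hv => hv ▸ ⟨hwx, haw, hbw⟩⟩⟩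
      by_contra hvw
      exact h.at_most_two a b x w v hne ha.symm haw h2 hb.symm hbw h3 hwx.symm h1.symm
        (Ne.symm hvw)
    · exact ⟨x, fun h1 h2 h3 => absurd ⟨h1, h2, h3⟩ hab⟩
  choose y hy using key
  exact ⟨y, hy⟩

section Opposite

variable {x a b c d t : V} {y : V → V → V}

theorem IsOpposite.ne (hy : IsOpposite G x y) (e : IsNbhd G x a b c d) : y a b ≠ x :=
  ((hy a b e.adj_a e.adj_b e.ab _).2 rfl).1

theorem IsOpposite.adj_left (hy : IsOpposite G x y) (e : IsNbhd G x a b c d) :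
    G.Adj a (y a b) :=
  ((hy a b e.adj_a e.adj_b e.ab _).2 rfl).2.1

theorem IsOpposite.adj_right (hy : IsOpposite G x y) (e : IsNbhd G x a b c d) :
    G.Adj b (y a b) :=
  ((hy a b e.adj_a e.adj_b e.ab _).2 rfl).2.2

theorem IsOpposite.comm (hy : IsOpposite G x y) (e : IsNbhd G x a b c d) : y a b = y b a :=
  (hy b a e.adj_b e.adj_a e.ab.symm _).1 ⟨hy.ne e, hy.adj_right e, hy.adj_left e⟩

theorem IsOpposite.not_adj (h : HasNoneOrTwoCommon G) (hy : IsOpposite G x y)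
    (e : IsNbhd G x a b c d) : ¬ G.Adj c (y a b) := fun hc =>
  h.at_most_two x (y a b) a b c (hy.ne e).symm e.adj_a e.adj_b e.adj_c (hy.adj_left e).symm
    (hy.adj_right e).symm hc.symm e.ab e.ac e.bc

theorem IsOpposite.ne_opposite (h : HasNoneOrTwoCommon G) (hy : IsOpposite G x y)
    (e : IsNbhd G x a b c d) : y a b ≠ y a c := fun heq =>
  hy.not_adj h e (heq ▸ hy.adj_right e.swap_bc)

theorem IsOpposite.ne_opposite' (h : HasNoneOrTwoCommon G) (hy : IsOpposite G x y)
    (e : IsNbhd G x a b c d) : y a b ≠ y c d := fun heq =>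
  hy.not_adj h e (heq ▸ hy.adj_left e.swap_bc.swap_ab.swap_cd.swap_bc)

theorem IsOpposite.eq_of_adj (h : HasNoneOrTwoCommon G) (hy : IsOpposite G x y)
    (e : IsNbhd G x a b c d) {v : V} (hv : G.Adj a v) :
    v = x ∨ v = y a b ∨ v = y a c ∨ v = y a d := by
  by_cases hvx : v = x
  · exact Or.inl hvx
  obtain ⟨w, hwa, hvw, hxw⟩ := h.exists_other v x a hvx hv.symm e.adj_a
  rcases (e.adj_iff w).1 hxw with rfl | rfl | rfl | rfl
  · exact absurd rfl hwa
  · exact Or.inr (Or.inl ((hy _ _ e.adj_a e.adj_b e.ab _).1 ⟨hvx, hv, hvw.symm⟩))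
  · exact Or.inr (Or.inr (Or.inl ((hy _ _ e.adj_a e.adj_c e.ac _).1 ⟨hvx, hv, hvw.symm⟩)))
  · exact Or.inr (Or.inr (Or.inr ((hy _ _ e.adj_a e.adj_d e.ad _).1 ⟨hvx, hv, hvw.symm⟩)))

/-- Among the six opposites, the vertex `t` is adjacent exactly to those of the triangle `abc`. -/
structure IsTriangleVertex (G : SimpleGraph V) (x : V) (y : V → V → V) (a b c d t : V) :
    Prop where
  not_adj : ¬ G.Adj x t
  ab : G.Adj t (y a b)
  ac : G.Adj t (y a c)
  bc : G.Adj t (y b c)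
  ad : ¬ G.Adj t (y a d)
  bd : ¬ G.Adj t (y b d)
  cd : ¬ G.Adj t (y c d)

/-- Among the six opposites, the vertex `t` is adjacent exactly to those of the four-cycle
`abdc`. -/
structure IsSquareVertex (G : SimpleGraph V) (x : V) (y : V → V → V) (a b c d t : V) :
    Prop where
  not_adj : ¬ G.Adj x t
  ab : G.Adj t (y a b)
  ac : G.Adj t (y a c)
  bd : G.Adj t (y b d)
  cd : G.Adj t (y c d)
  ad : ¬ G.Adj t (y a d)
  bc : ¬ G.Adj t (y b c)

/-- A common neighbor `t ≠ a` of `y a b` and `y a c` shares `0` or `2` neighbors with each of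
`a, b, c, d`. Read as a set of edges on `a, b, c, d`, its neighbors among the opposites therefore
have degree `0` or `2` at each of these points, so that they form a triangle or a four-cycle. -/
theorem IsOpposite.triangle_or_square (h : HasNoneOrTwoCommon G) (hy : IsOpposite G x y)
    (e : IsNbhd G x a b c d) (hta : t ≠ a) (h1 : G.Adj t (y a b)) (h2 : G.Adj t (y a c)) :
    IsTriangleVertex G x y a b c d t ∨ IsSquareVertex G x y a b c d t := by
  have hba := hy.comm e
  have hca := hy.comm e.swap_bc
  have hbc := hy.comm e.swap_ab.swap_bc
  have hab_ac := hy.ne_opposite h e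
  have hab_ad := hy.ne_opposite h e.swap_cd
  have hac_ad := hy.ne_opposite h e.swap_bc.swap_cd
  have hba_bc := hy.ne_opposite h e.swap_ab
  have hba_bd := hy.ne_opposite h e.swap_ab.swap_cd
  have hbc_bd := hy.ne_opposite h e.swap_ab.swap_bc.swap_cd
  have hca_cb := hy.ne_opposite h e.swap_bc.swap_ab
  have hca_cd := hy.ne_opposite h e.swap_bc.swap_ab.swap_cd
  have hcb_cd := hy.ne_opposite h e.swap_bc.swap_ab.swap_bc.swap_cd
  have aab := hy.adj_left e
  have aac := hy.adj_left e.swap_bc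
  have aad := hy.adj_left e.swap_cd.swap_bc
  have bab := hy.adj_right e
  have bbc := hy.adj_left e.swap_ab.swap_bc
  have bbd := hy.adj_left e.swap_ab.swap_cd.swap_bc
  have cac := hy.adj_right e.swap_bc
  have cbc := hy.adj_right e.swap_ab.swap_bc
  have ccd := hy.adj_left e.swap_bc.swap_ab.swap_cd.swap_bc
  have htb : t ≠ b := by rintro rfl; exact hy.not_adj h e.swap_bc h2
  have htc : t ≠ c := by rintro rfl; exact hy.not_adj h e h1
  have htd : t ≠ d := by rintro rfl; exact hy.not_adj h e.swap_cd h1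
  have hxt : ¬ G.Adj x t := fun hx => by
    rcases (e.adj_iff t).1 hx with h | h | h | h
    exacts [hta h, htb h, htc h, htd h]
  have had : ¬ G.Adj t (y a d) := fun had =>
    h.at_most_two a t _ _ _ hta.symm aab aac aad h1 h2 had hab_ac hab_ad hac_ad
  have hb : G.Adj t (y b c) ∨ G.Adj t (y b d) := by
    obtain ⟨w, hw, hbw, htw⟩ := h.exists_other b t _ htb.symm bab h1
    rcases hy.eq_of_adj h e.swap_ab hbw with rfl | rfl | rfl | rfl
    · exact absurd htw.symm hxt
    · exact absurd hba.symm hw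
    · exact Or.inl htw
    · exact Or.inr htw
  have hc : G.Adj t (y b c) ∨ G.Adj t (y c d) := by
    obtain ⟨w, hw, hcw, htw⟩ := h.exists_other c t _ htc.symm cac h2
    rcases hy.eq_of_adj h e.swap_bc.swap_ab hcw with rfl | rfl | rfl | rfl
    · exact absurd htw.symm hxt
    · exact absurd hca.symm hw
    · rw [hbc]; exact Or.inl htw
    · exact Or.inr htw
  by_cases htbc : G.Adj t (y b c)
  · refine Or.inl ⟨hxt, h1, h2, htbc, had, fun hbd => ?_, fun hcd => ?_⟩
    · exact h.at_most_two b t _ _ _ htb.symm bab bbc bbd h1 htbc hbd (hba ▸ hba_bc) (hba ▸ hba_bd)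
        hbc_bd
    · exact h.at_most_two c t _ _ _ htc.symm cac cbc ccd h2 htbc hcd
        (by rw [hca, hbc]; exact hca_cb) (by rw [hca]; exact hca_cd) (by rw [hbc]; exact hcb_cd)
  · exact Or.inr ⟨hxt, h1, h2, hb.resolve_left htbc, hc.resolve_left htbc, had, htbc⟩

theorem IsOpposite.exists_common (h : HasNoneOrTwoCommon G) (hy : IsOpposite G x y)
    (e : IsNbhd G x a b c d) : ∃ t, t ≠ a ∧ G.Adj t (y a b) ∧ G.Adj t (y a c) := by
  obtain ⟨t, ht, h1, h2⟩ := h.exists_other _ _ a (hy.ne_opposite h e) (hy.adj_left e).symm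
    (hy.adj_left e.swap_bc).symm
  exact ⟨t, ht, h1.symm, h2.symm⟩

/-- A triangle vertex for `abc` excludes a square vertex through `ab` and `bc`, since `b` and these
two would be three common neighbors of `y a b` and `y b c`. So there is a triangle vertex for
`abd`. -/
theorem IsTriangleVertex.exists_next (h : HasNoneOrTwoCommon G) (hy : IsOpposite G x y)
    (e : IsNbhd G x a b c d) (ht : IsTriangleVertex G x y a b c d t) :
    ∃ t', IsTriangleVertex G x y a b d c t' := by
  obtain ⟨t', ht', h1, h2⟩ := hy.exists_common h e.swap_cd
  rcases hy.triangle_or_square h e.swap_cd ht' h1 h2 with h3 | h3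
  · exact ⟨t', h3⟩
  have hbt : b ≠ t := by rintro rfl; exact ht.not_adj e.adj_b
  have hbt' : b ≠ t' := by rintro rfl; exact h3.not_adj e.adj_b
  have htt' : t ≠ t' := by rintro rfl; exact ht.ad h2
  exact (h.at_most_two (y a b) (y b c) b t t' (by rw [hy.comm e]; exact hy.ne_opposite h e.swap_ab)
    (hy.adj_right e).symm ht.ab.symm h3.ab.symm (hy.adj_left e.swap_ab.swap_bc).symm ht.bc.symm
    h3.bd.symm hbt hbt' htt').elim

theorem IsTriangleVertex.rotate (hy : IsOpposite G x y) (e : IsNbhd G x a b c d)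
    (ht : IsTriangleVertex G x y a b c d t) : IsTriangleVertex G x y b c a d t :=
  ⟨ht.not_adj, ht.bc, by rw [hy.comm e.swap_ab]; exact ht.ab,
    by rw [hy.comm e.swap_bc.swap_ab]; exact ht.ac, ht.bd, ht.cd, ht.ad⟩

end Opposite

end TriangleFree

section Assembly

variable {V : Type*} [Fintype V] [DecidableEq V] {G : SimpleGraph V} [DecidableRel G.Adj]
  {x a b c d : V} {y : V → V → V}

/-- The edges of the `4`-cube, with the even strings numbered `0, …, 7` and the odd ones
`8, …, 15`, in both cases by weight and then in the lexicographic order of the supports. -/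
def edgesCube : Finset (Sym2 (Fin 16)) :=
  {s(0, 8), s(0, 9), s(0, 10), s(0, 11), s(1, 8), s(1, 9), s(1, 12), s(1, 13),
    s(2, 8), s(2, 10), s(2, 12), s(2, 14), s(3, 8), s(3, 11), s(3, 13), s(3, 14),
    s(4, 9), s(4, 10), s(4, 12), s(4, 15), s(5, 9), s(5, 11), s(5, 13), s(5, 15),
    s(6, 10), s(6, 11), s(6, 14), s(6, 15), s(7, 12), s(7, 13), s(7, 14), s(7, 15)}

theorem nonempty_iso_graphQ₄ :
    Nonempty (SimpleGraph.fromEdgeSet (edgesCube : Set (Sym2 (Fin 16))) ≃g graphQ₄) := by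
  let g : Fin 16 → Fin 4 → Bool :=
    ![![false, false, false, false], ![true, true, false, false], ![true, false, true, false],
      ![true, false, false, true], ![false, true, true, false], ![false, true, false, true],
      ![false, false, true, true], ![true, true, true, true],
      ![true, false, false, false], ![false, true, false, false], ![false, false, true, false],
      ![false, false, false, true], ![true, true, true, false], ![true, true, false, true],
      ![true, false, true, true], ![false, true, true, true]]
  have hg : Function.Bijective g := by
    rw [Fintype.bijective_iff_injective_and_card]
    exact ⟨by decide, by simp⟩
  refine ⟨{ toEquiv := Equiv.ofBijective g hg, map_rel_iff' := ?_ }⟩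
  intro i j
  simp only [Equiv.ofBijective_apply, graphQ₄, SimpleGraph.fromEdgeSet_adj, Finset.mem_coe]
  revert i j
  decide

/-- The vertex `x` and the six opposites are distinct. -/
theorem IsOpposite.nodup {V : Type*} {G : SimpleGraph V} {x a b c d : V} {y : V → V → V}
    (h : HasNoneOrTwoCommon G) (hy : IsOpposite G x y) (e : IsNbhd G x a b c d) :
    [x, y a b, y a c, y a d, y b c, y b d, y c d].Nodup := by
  have hba := hy.comm e.swap_ab
  have hca := hy.comm e.swap_bc.swap_ab
  have hda := hy.comm e.swap_cd.swap_bc.swap_ab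
  have hcb := hy.comm e.swap_ab.swap_bc.swap_ab
  have hdb := hy.comm e.swap_ab.swap_cd.swap_bc.swap_ab
  have hdc := hy.comm e.swap_bc.swap_ab.swap_cd.swap_bc.swap_ab
  have ne1 := hy.ne e
  have ne2 := hy.ne e.swap_bc
  have ne3 := hy.ne e.swap_cd.swap_bc
  have ne4 := hy.ne e.swap_ab.swap_bc
  have ne5 := hy.ne e.swap_ab.swap_cd.swap_bc
  have ne6 := hy.ne e.swap_bc.swap_ab.swap_cd.swap_bc
  have n1 := hy.ne_opposite h e
  have n2 := hy.ne_opposite h e.swap_cd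
  have n3 := hy.ne_opposite h e.swap_bc.swap_cd
  have n4 := hy.ne_opposite h e.swap_ab
  have n5 := hy.ne_opposite h e.swap_ab.swap_cd
  have n6 := hy.ne_opposite h e.swap_ab.swap_bc.swap_cd
  have n7 := hy.ne_opposite h e.swap_bc.swap_ab
  have n8 := hy.ne_opposite h e.swap_bc.swap_ab.swap_cd
  have n9 := hy.ne_opposite h e.swap_bc.swap_ab.swap_bc.swap_cd
  have n10 := hy.ne_opposite h e.swap_cd.swap_bc.swap_ab
  have n11 := hy.ne_opposite h e.swap_cd.swap_bc.swap_ab.swap_cd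
  have n12 := hy.ne_opposite h e.swap_cd.swap_bc.swap_ab.swap_bc.swap_cd
  have n13 := hy.ne_opposite' h e
  have n14 := hy.ne_opposite' h e.swap_bc
  have n15 := hy.ne_opposite' h e.swap_cd.swap_bc
  rw [hba] at n4 n5
  rw [hca] at n7 n8
  rw [hcb] at n7 n9
  rw [hda] at n10 n11
  rw [hdb] at n10 n12
  rw [hdc] at n11 n12
  simp only [List.nodup_cons, List.mem_cons, List.not_mem_nil, or_false, not_or, List.nodup_nil,
    and_true, not_false_eq_true]
  exact ⟨⟨ne1.symm, ne2.symm, ne3.symm, ne4.symm, ne5.symm, ne6.symm⟩, ⟨n1, n2, n4, n5, n13⟩,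
    ⟨n3, n7, n14, n8⟩, ⟨n15, n10, n11⟩, ⟨n6, n9⟩, n12⟩

/-- The edges between the neighbors of `x` and the opposites. -/
theorem IsOpposite.adj_all {V : Type*} {G : SimpleGraph V} {x a b c d : V} {y : V → V → V}
    (hy : IsOpposite G x y) (e : IsNbhd G x a b c d) :
    (G.Adj a (y a b) ∧ G.Adj a (y a c) ∧ G.Adj a (y a d)) ∧
    (G.Adj b (y a b) ∧ G.Adj b (y b c) ∧ G.Adj b (y b d)) ∧
    (G.Adj c (y a c) ∧ G.Adj c (y b c) ∧ G.Adj c (y c d)) ∧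
    (G.Adj d (y a d) ∧ G.Adj d (y b d) ∧ G.Adj d (y c d)) := by
  have aab := hy.adj_left e
  have aac := hy.adj_left e.swap_bc
  have aad := hy.adj_left e.swap_cd.swap_bc
  have bab := hy.adj_right e
  have bbc := hy.adj_left e.swap_ab.swap_bc
  have bbd := hy.adj_left e.swap_ab.swap_cd.swap_bc
  have cac := hy.adj_right e.swap_bc
  have cbc := hy.adj_right e.swap_ab.swap_bc
  have ccd := hy.adj_left e.swap_bc.swap_ab.swap_cd.swap_bc
  have dad := hy.adj_right e.swap_cd.swap_bc
  have dbd := hy.adj_right e.swap_ab.swap_cd.swap_bc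
  have dcd := hy.adj_right e.swap_bc.swap_ab.swap_cd.swap_bc
  exact ⟨⟨aab, aac, aad⟩, ⟨bab, bbc, bbd⟩, ⟨cac, cbc, ccd⟩, ⟨dad, dbd, dcd⟩⟩

/-- If one triangle vertex exists, then all four do, and they have a common fourth neighbor `z`. The
resulting injective homomorphism from `Q₄` sends a string with support `S` to `x`, to a neighbor of
`x`, to an opposite, to a triangle vertex or to `z`, according to the size of `S`. -/
theorem IsOpposite.nonempty_iso_graphQ₄ (h : HasNoneOrTwoCommon G) (hconn : G.Connected)
    (hreg : G.IsRegularOfDegree 4) (htf : ∀ u v w, G.Adj u v → G.Adj u w → ¬ G.Adj v w)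
    (hy : IsOpposite G x y) (e : IsNbhd G x a b c d) {t₁ : V}
    (h₁ : IsTriangleVertex G x y a b c d t₁) : Nonempty (G ≃g graphQ₄) := by
  have hba := hy.comm e.swap_ab
  have hca := hy.comm e.swap_bc.swap_ab
  have hda := hy.comm e.swap_cd.swap_bc.swap_ab
  have hcb := hy.comm e.swap_ab.swap_bc.swap_ab
  have hdb := hy.comm e.swap_ab.swap_cd.swap_bc.swap_ab
  have hdc := hy.comm e.swap_bc.swap_ab.swap_cd.swap_bc.swap_ab
  obtain ⟨t₂, h₂⟩ := h₁.exists_next h hy e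
  obtain ⟨t₄, h₄⟩ := (h₁.rotate hy e).exists_next h hy e.swap_ab.swap_bc
  obtain ⟨t₃, h₃⟩ := ((h₁.rotate hy e).rotate hy e.swap_ab.swap_bc).exists_next h hy
    e.swap_bc.swap_ab
  obtain ⟨_, b₁, b₂, b₃, b₄, b₅, b₆⟩ := h₂
  obtain ⟨_, c₁, c₂, c₃, c₄, c₅, c₆⟩ := h₃
  obtain ⟨_, d₁, d₂, d₃, d₄, d₅, d₆⟩ := h₄
  obtain ⟨_, a₁, a₂, a₃, a₄, a₅, a₆⟩ := h₁
  rw [hca] at c₁; rw [hcb] at c₄; rw [hdb] at c₆; rw [hba] at d₄; rw [hca] at d₅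
  rw [hda] at d₆; rw [hdc] at b₆
  obtain ⟨z, z₁, z₂, z₃, hz⟩ := exists_fourth_neighbor hreg a₁ a₂ a₃
    (hy.ne_opposite h e) (by rw [hy.comm e]; exact hy.ne_opposite h e.swap_ab)
    (by rw [hy.comm e.swap_bc, ← hcb]; exact hy.ne_opposite h e.swap_bc.swap_ab)
  -- Each other triangle vertex shares one opposite with `t₁`, hence also the fourth neighbor `z`.
  have tz₁ : G.Adj t₁ z := (hz z).2 (by simp)
  have tz₂ : G.Adj t₂ z := by
    obtain ⟨w, hw, h1, h2⟩ := h.exists_other t₁ t₂ _ (fun heq => a₄ (heq ▸ b₂)) a₁ b₁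
    rcases (hz w).1 h1 with rfl | rfl | rfl | rfl
    exacts [absurd rfl hw, absurd h2 b₄, absurd h2 b₅, h2]
  have tz₃ : G.Adj t₃ z := by
    obtain ⟨w, hw, h1, h2⟩ := h.exists_other t₁ t₃ _ (fun heq => a₄ (heq ▸ c₃)) a₂ c₁
    rcases (hz w).1 h1 with rfl | rfl | rfl | rfl
    exacts [absurd h2 c₅, absurd rfl hw, absurd h2 c₄, h2]
  have tz₄ : G.Adj t₄ z := by
    obtain ⟨w, hw, h1, h2⟩ := h.exists_other t₁ t₄ _ (fun heq => a₅ (heq ▸ d₂)) a₃ d₁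
    rcases (hz w).1 h1 with rfl | rfl | rfl | rfl
    exacts [absurd h2 d₄, absurd h2 d₅, absurd rfl hw, h2]
  obtain ⟨⟨aab, aac, aad⟩, ⟨bab, bbc, bbd⟩, ⟨cac, cbc, ccd⟩, ⟨dad, dbd, dcd⟩⟩ := hy.adj_all e
  have hnodup := hy.nodup h e
  obtain ⟨ab, ac, ad, bc, bd, cd, hx⟩ := id e
  have xa := e.adj_a
  have xb := e.adj_b
  have xc := e.adj_c
  have xd := e.adj_d
  suffices h : Nonempty (G ≃g SimpleGraph.fromEdgeSet (edgesCube : Set (Sym2 (Fin 16)))) from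
    ⟨h.some.trans SkewEnergy.nonempty_iso_graphQ₄.some⟩
  refine nonempty_iso_fromEdgeSet hconn hreg (by decide)
    (f := ![x, y a b, y a c, y a d, y b c, y b d, y c d, z, a, b, c, d, t₁, t₂, t₃, t₄]) ?_ ?_
  rotate_left
  · simp only [edgesCube, Finset.forall_mem_insert, Finset.mem_singleton, forall_eq, Sym2.map_mk,
      SimpleGraph.mem_edgeSet]
    exact ⟨xa, xb, xc, xd, aab.symm, bab.symm, a₁.symm, b₁.symm, aac.symm, cac.symm, a₂.symm,
      c₁.symm, aad.symm, dad.symm, b₂.symm, c₃.symm, bbc.symm, cbc.symm, a₃.symm, d₁.symm,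
      bbd.symm, dbd.symm, b₃.symm, d₂.symm, ccd.symm, dcd.symm, c₂.symm, d₃.symm,
      tz₁.symm, tz₂.symm, tz₃.symm, tz₄.symm⟩
  clear hz hy hba hca hda hcb hdb hdc hreg hconn e hx
  generalize y a b = p₁ at *
  generalize y a c = p₂ at *
  generalize y a d = p₃ at *
  generalize y b c = p₄ at *
  generalize y b d = p₅ at *
  generalize y c d = p₆ at *
  simp only [List.ofFn_succ, List.ofFn_zero, List.nodup_cons, List.mem_cons, List.not_mem_nil,
    or_false, not_or, Matrix.cons_val_zero, Matrix.cons_val_succ, List.nodup_nil, and_true,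
    not_false_eq_true] at hnodup ⊢
  obtain ⟨⟨_, _, _, _, _, _⟩, ⟨_, _, _, _, _⟩, ⟨_, _, _, _⟩, ⟨_, _, _⟩, ⟨_, _⟩, _⟩ := hnodup
  have sym : ∀ u v, G.Adj u v → G.Adj v u := fun u v h => h.symm
  have irr : ∀ u, ¬ G.Adj u u := fun u => G.irrefl
  clear h
  -- Two vertices on the same side of the bipartition differ because some vertex is adjacent to only
  -- one of them; those on different sides are the ends of an edge or of a path of length three.
  repeat' apply And.intro
  all_goals grind

/-- Given a square vertex for each of the three four-cycles on `a, b, c, d`, the seven vertices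
formed by `x` and the opposites and the seven vertices `a, b, c, d, t₁, t₂, t₃` carry a copy of `G₃`. -/
theorem IsOpposite.nonempty_iso_graphG₃ (h : HasNoneOrTwoCommon G) (hconn : G.Connected)
    (hreg : G.IsRegularOfDegree 4) (htf : ∀ u v w, G.Adj u v → G.Adj u w → ¬ G.Adj v w)
    (hy : IsOpposite G x y) (e : IsNbhd G x a b c d) {t₁ t₂ t₃ : V}
    (h₁ : IsSquareVertex G x y a b c d t₁) (h₂ : IsSquareVertex G x y a b d c t₂)
    (h₃ : IsSquareVertex G x y a c d b t₃) : Nonempty (G ≃g graphG₃) := by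
  have hcb := hy.comm e.swap_ab.swap_bc.swap_ab
  have hdb := hy.comm e.swap_ab.swap_cd.swap_bc.swap_ab
  have hdc := hy.comm e.swap_bc.swap_ab.swap_cd.swap_bc.swap_ab
  obtain ⟨_, a₁, a₂, a₃, a₄, a₅, a₆⟩ := h₁
  obtain ⟨_, b₁, b₂, b₃, b₄, b₅, b₆⟩ := h₂
  obtain ⟨_, c₁, c₂, c₃, c₄, c₅, c₆⟩ := h₃
  rw [hdc] at b₄; rw [hcb] at c₃; rw [hdb] at c₄
  obtain ⟨⟨aab, aac, aad⟩, ⟨bab, bbc, bbd⟩, ⟨cac, cbc, ccd⟩, ⟨dad, dbd, dcd⟩⟩ := hy.adj_all e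
  have hnodup := hy.nodup h e
  obtain ⟨ab, ac, ad, bc, bd, cd, hx⟩ := id e
  have xa := e.adj_a
  have xb := e.adj_b
  have xc := e.adj_c
  have xd := e.adj_d
  refine nonempty_iso_fromEdgeSet hconn hreg (E := edgesG₃) (by decide)
    (f := ![x, a, b, c, d, y a b, y a c, y a d, y b c, y b d, y c d, t₁, t₂, t₃]) ?_ ?_
  rotate_left
  · simp only [edgesG₃, Finset.forall_mem_insert, Finset.mem_singleton, forall_eq, Sym2.map_mk,
      SimpleGraph.mem_edgeSet]
    exact ⟨xa, xb, xc, xd, aab, aac, aad, bab, bbc, bbd, cac, cbc, ccd, dad, dbd, dcd,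
      a₁.symm, b₁.symm, a₂.symm, c₁.symm, b₂.symm, c₂.symm, b₃.symm, c₃.symm, a₃.symm, c₄.symm,
      a₄.symm, b₄.symm⟩
  clear hy hcb hdb hdc hreg hconn e hx
  generalize y a b = p₁ at *
  generalize y a c = p₂ at *
  generalize y a d = p₃ at *
  generalize y b c = p₄ at *
  generalize y b d = p₅ at *
  generalize y c d = p₆ at *
  simp only [List.ofFn_succ, List.ofFn_zero, List.nodup_cons, List.mem_cons, List.not_mem_nil,
    or_false, not_or, Matrix.cons_val_zero, Matrix.cons_val_succ, List.nodup_nil, and_true,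
    not_false_eq_true] at hnodup ⊢
  obtain ⟨⟨_, _, _, _, _, _⟩, ⟨_, _, _, _, _⟩, ⟨_, _, _, _⟩, ⟨_, _, _⟩, ⟨_, _⟩, _⟩ := hnodup
  have sym : ∀ u v, G.Adj u v → G.Adj v u := fun u v h => h.symm
  have irr : ∀ u, ¬ G.Adj u u := fun u => G.irrefl
  clear h
  -- Two vertices on the same side of the bipartition differ because some vertex is adjacent to only
  -- one of them; those on different sides are the ends of an edge or of a path of length three.
  repeat' apply And.intro
  all_goals grind

/-- A triangle-free graph without twins is `Q₄` or `G₃`. -/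
theorem HasNoneOrTwoCommon.iso_of_triangleFree (h : HasNoneOrTwoCommon G) (hconn : G.Connected)
    (hreg : G.IsRegularOfDegree 4) (htf : ∀ u v w, G.Adj u v → G.Adj u w → ¬ G.Adj v w) :
    Nonempty (G ≃g graphG₃) ∨ Nonempty (G ≃g graphQ₄) := by
  obtain ⟨x⟩ := hconn.nonempty
  obtain ⟨a, b, c, d, e⟩ := exists_isNbhd hreg x
  obtain ⟨y, hy⟩ := h.exists_isOpposite x
  obtain ⟨t₁, ht₁, h1, h1'⟩ := hy.exists_common h e
  obtain ⟨t₂, ht₂, h2, h2'⟩ := hy.exists_common h e.swap_cd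
  obtain ⟨t₃, ht₃, h3, h3'⟩ := hy.exists_common h e.swap_bc.swap_cd
  rcases hy.triangle_or_square h e ht₁ h1 h1' with k1 | k1
  · exact Or.inr (hy.nonempty_iso_graphQ₄ h hconn hreg htf e k1)
  rcases hy.triangle_or_square h e.swap_cd ht₂ h2 h2' with k2 | k2
  · exact Or.inr (hy.nonempty_iso_graphQ₄ h hconn hreg htf e.swap_cd k2)
  rcases hy.triangle_or_square h e.swap_bc.swap_cd ht₃ h3 h3' with k3 | k3
  · exact Or.inr (hy.nonempty_iso_graphQ₄ h hconn hreg htf e.swap_bc.swap_cd k3)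
  exact Or.inl (hy.nonempty_iso_graphG₃ h hconn hreg htf e k1 k2 k3)

end Assembly

end SkewEnergy

theorem theorem3p3 {V : Type*} [Fintype V] [DecidableEq V] (G : SimpleGraph V)
    [DecidableRel G.Adj] (hconn : G.Connected) (hreg : G.IsRegularOfDegree 4)
    (σ : SkewEnergy.GraphOrientation G) (hopt : σ.IsOptimum) :
    SkewEnergy.MemF G := by
  have := hconn.nonempty
  have hs : SkewEnergy.OrthogonalSigning G σ.skewAdjMatrix :=
    ⟨σ.skewAdjMatrix_swap, fun _ _ => σ.skewAdjMatrix_eq_one_or,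
      fun _ _ => σ.skewAdjMatrix_eq_zero, fun _ _ => hopt.sum_mul_eq_zero hreg⟩
  by_cases htwin : ∃ x y, x ≠ y ∧ G.neighborFinset x = G.neighborFinset y
  · obtain ⟨x, y, hxy, h⟩ := htwin
    exact SkewEnergy.memF_of_twins hs hconn hreg hxy h
  push Not at htwin
  have h := hs.hasNoneOrTwoCommon hreg htwin
  by_cases htri : ∃ u v w, G.Adj u v ∧ G.Adj u w ∧ G.Adj v w
  · obtain ⟨u, v, w, huv, huw, hvw⟩ := htri
    exact Or.inl (h.nonempty_iso_graphG₁ hconn hreg huv huw hvw)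
  push Not at htri
  rcases h.iso_of_triangleFree hconn hreg htri with h | h
  · exact Or.inr (Or.inr (Or.inl h))
  · exact Or.inr (Or.inr (Or.inr (Or.inl h)))
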